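/- \textbf{Setting.} Let $\mathcal T$ be a finite simplicial mesh (a finite geometric simplicial complex in a real vector space, e.g. $\mathbb R^3$), with nodes $\mathcal T^0$, edges $\mathcal T^1$ and facets (triangles) $\mathcal T^2$, which triangulates a closed oriented surface $\Gamma_h=\bigcup_{t\in\mathcal T^2}\overline t$: every cell lies in a facet, every edge lies in exactly two facets, and the facets around each node are connected through common edges at that node. The surface need not be connected. The edges are arbitrarily oriented, and all facets are in the orientation of the surface. Let $D^0_{as},D^1_{st}\in\{-1,0,1\}$ be the incidence numbers (node $a$, edge $s$; edge $s$, facet $t$), so that $\mathrm d\lambda^r_s=\sum_t D^r_{st}\lambda^{r+1}_t$ for the Whitney forms of $\mathcal T$. Let $\widetilde{\mathcal T}$ be the barycentric refinement with standard Whitney bases $\tilde\lambda^q_w$, $w\in\widetilde{\mathcal T}^q$, and incidence numbers $\widetilde D$; its cells are oriented by ordering the barycentres of cells $\sigma_0\subset\dots\subset\sigma_q$ of $\mathcal T$ in this order. Let $\mathcal V$ be the barycentric dual mesh, with dual cells $\star t\in\mathcal V^{q}$ for $t\in\mathcal T^r$, $r+q=2$, oriented so that $(\star t,t)$ is in the orientation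 of the surface, and written as chains $v=\sum_{w\in\widetilde{\mathcal T}^q}c^q_{vw}w$ with $c^q_{vw}\in\{-1,0,1\}$. The Buffa--Christiansen (B-C) forms are $\mu^q_v=\sum_{w\in\widetilde{\mathcal T}^q}R^q_{vw}\tilde\lambda^q_w$, $v\in\mathcal V^q$, $q=0,1,2$, with real coefficients $R^q_{vw}$ subject to the following rules. \begin{enumerate} \item (Local support) Let $U^2_v=\overline v$ and, for $q=1,0$, let $U^q_v$ be the union of the $U^{q+1}_u$ over all $u\in\mathcal V^{q+1}$ with $v\subset\partial u$. Then $R^q_{vw}=0$ if $w\not\subset U^q_v$ or $w\subset\partial U^q_v$. \item (Equal weights) $R^q_{vw}=c^q_{vw}/n_v$ whenever $c^q_{vw}\neq0$, where $n_v=\sum_{w}|c^q_{vw}|$. \item (Stability) For an edge $s\in\mathcal T^1$ and $w\in\widetilde{\mathcal T}^1$ with $w\subset s$, $R^1_{\star s,w}=0$. \item (Remaining coefficients) For every $s\in\mathcal T^1$ and every $z\in\widetilde{\mathcal T}^2$ with $z\subset U^1_{\star s}$, $$\sum_{w\in\widetilde{\mathcal T}^1}R^1_{\star s,w}\widetilde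 D^1_{wz}=\sum_{a\in\mathcal T^0}D^0_{as}R^2_{\star a,z},$$ and for every $t\in\mathcal T^2$ and every $z\in\widetilde{\mathcal T}^1$ with $z\subset U^0_{\star t}$, $$\sum_{w\in\widetilde{\mathcal T}^0}R^0_{\star t,w}\widetilde D^0_{wz}=-\sum_{s\in\mathcal T^1}D^1_{st}R^1_{\star s,z}.$$ \end{enumerate} \textbf{Proposition (Partition of Unity).} There is exactly one family of coefficients $(R^0,R^1,R^2)$ that satisfies these rules, and the resulting B-C $0$-forms sum to the constant function one on the surface: $$\sum_{v\in\mathcal V^0}\mu^0_v(x)=1\qquad\text{for all }x\in\Gamma_h .$$ -/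

import Mathlib

namespace BuffaChristiansen

noncomputable section

open scoped Classical

variable {E : Type*} [AddCommGroup E] [Module ℝ E]

/-! ### The mesh `𝒯` and its barycentric refinement -/

/-- `𝒯^r`: the cells of dimension `r` (nodes, edges and facets for `r = 0, 1, 2`), given by their
vertices. -/
abbrev Cell (K : Geometry.SimplicialComplex ℝ E) (r : ℕ) : Type _ :=
  {t : Finset E // t ∈ K.faces ∧ t.card = r + 1}

/-- `Γ_h`, the union of the closed facets of the mesh. -/
def interface (K : Geometry.SimplicialComplex ℝ E) : Set E :=
  ⋃ t : Cell K 2, convexHull ℝ (t.1 : Set E)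

/-- The `q`-cells of the barycentric refinement: the small simplex with vertices the barycentres
of `w 0 ⊂ w 1 ⊂ ... ⊂ w q`, a strictly increasing sequence of cells of the mesh. It is oriented by
this order of its vertices. -/
abbrev SmallCell (K : Geometry.SimplicialComplex ℝ E) (q : ℕ) : Type _ :=
  {w : Fin (q + 1) → Finset E // StrictMono w ∧ ∀ i, w i ∈ K.faces}

instance (K : Geometry.SimplicialComplex ℝ E) [Finite K.faces] (r : ℕ) : Fintype (Cell K r) :=
  have : Finite (Cell K r) :=
    Finite.of_injective (fun t : Cell K r => (⟨t.1, t.2.1⟩ : K.faces))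
      (fun _ _ h => Subtype.ext (congrArg (fun s : K.faces => s.1) h))
  Fintype.ofFinite _

instance (K : Geometry.SimplicialComplex ℝ E) [Finite K.faces] (q : ℕ) :
    Fintype (SmallCell K q) :=
  have : Finite (SmallCell K q) :=
    Finite.of_injective (fun (w : SmallCell K q) (i : Fin (q + 1)) => (⟨w.1 i, w.2.2 i⟩ : K.faces))
      (fun _ _ h => Subtype.ext (funext fun i => congrArg Subtype.val (congrFun h i)))
  Fintype.ofFinite _

/-- The mesh triangulates a closed surface: every cell lies in a facet (so no cell has dimension
larger than two), every edge lies in exactly two facets (no boundary), and the facets around a node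
are connected through common edges at that node (so that they form one cycle). The surface itself
need not be connected. -/
structure IsClosedSurface (K : Geometry.SimplicialComplex ℝ E) : Prop where
  pure : ∀ σ ∈ K.faces, ∃ t : Cell K 2, σ ⊆ t.1
  two_facets : ∀ s : Cell K 1, {t : Cell K 2 | s.1 ⊆ t.1}.ncard = 2
  star_connected : ∀ (a : Cell K 0) (t t' : Cell K 2), a.1 ⊆ t.1 → a.1 ⊆ t'.1 →
    Relation.ReflTransGen
      (fun u u' : Cell K 2 => ∃ s : Cell K 1, a.1 ⊆ s.1 ∧ s.1 ⊆ u.1 ∧ s.1 ⊆ u'.1) t t'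

/-- Orientations of the edges and facets of the mesh: every edge is given as the ordered pair
(tail, head) of its end points, and every facet as an ordered triple of its vertices. -/
structure CellOrientation (K : Geometry.SimplicialComplex ℝ E) where
  edge : Cell K 1 → Fin 2 → E
  range_edge : ∀ s, Set.range (edge s) = (s.1 : Set E)
  facet : Cell K 2 → Fin 3 → E
  range_facet : ∀ t, Set.range (facet t) = (t.1 : Set E)

variable {K : Geometry.SimplicialComplex ℝ E}

namespace CellOrientation

/-- The incidence number `D⁰_{as}` (node `a`, edge `s`): `1` if `a` is the head of `s`, `-1` if it
is the tail, `0` otherwise. -/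
def D0 (o : CellOrientation K) (a : Cell K 0) (s : Cell K 1) : ℝ :=
  (if a.1 = {o.edge s 1} then 1 else 0) - (if a.1 = {o.edge s 0} then 1 else 0)

/-- The incidence number `D¹_{st}` (edge `s`, facet `t`): the coefficient of `s` in the boundary
`(t₀,t₁) + (t₁,t₂) + (t₂,t₀)` of the oriented facet `t = (t₀,t₁,t₂)`. -/
def D1 (o : CellOrientation K) (s : Cell K 1) (t : Cell K 2) : ℝ :=
  ∑ i : Fin 3,
    ((if o.edge s 0 = o.facet t i ∧ o.edge s 1 = o.facet t (i + 1) then 1 else 0) -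
      (if o.edge s 1 = o.facet t i ∧ o.edge s 0 = o.facet t (i + 1) then 1 else 0))

/-- The facets are all in the orientation of one orientation of the surface: two distinct facets
induce opposite orientations on a common edge. -/
def IsCoherent (o : CellOrientation K) : Prop :=
  ∀ (s : Cell K 1) (t t' : Cell K 2), t ≠ t' → s.1 ⊆ t.1 → s.1 ⊆ t'.1 → o.D1 s t = -o.D1 s t'

end CellOrientation

/-- The incidence number `D̃_{wz}` in the barycentric refinement, with the usual alternating signs:
the matrix of the exterior derivative in the standard Whitney bases of the refinement. -/
def smallD {q : ℕ} (w : SmallCell K q) (z : SmallCell K (q + 1)) : ℝ :=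
  ∑ i : Fin (q + 2), if w.1 = z.1 ∘ i.succAbove then (-1) ^ (i : ℕ) else 0

/-! ### The barycentric dual mesh

The dual cell `⋆t` of a primal cell `t ∈ 𝒯^r` has dimension `q = 2 - r`; it is the union of the
small cells `w` of dimension `q` with `w 0 = t`. Objects indexed by dual `q`-cells `⋆t` are
indexed by `t`. The orientation of `⋆t` is such that `(⋆t, t)` is in the orientation of the
surface; the numbers `c` below are the coefficients of the chain `⋆t = ∑ c_w w`. -/

/-- `q = 0`: the dual node of a facet `t` is its barycentre, with sign `1`. -/
def chain0 (t : Cell K 2) (w : SmallCell K 0) : ℝ :=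
  if w.1 0 = t.1 then 1 else 0

/-- `q = 1`: the dual edge of `s` consists of the small edges from the barycentre of `s` to the
barycentres of the two adjacent facets `t`. If `D¹_{st} = 1`, the facet `t` is to the left of `s`,
and (direction from `s` into `t`, direction of `s`) is a negatively oriented frame. -/
def chain1 [Finite K.faces] (o : CellOrientation K) (s : Cell K 1) (w : SmallCell K 1) : ℝ :=
  ∑ t : Cell K 2, if w.1 0 = s.1 ∧ w.1 1 = t.1 then -o.D1 s t else 0

/-- `q = 2`: the dual cell of a node `a` consists of the small triangles `a ⊂ s ⊂ t`, whose
orientation agrees with that of the surface iff the edge `s`, directed away from `a`, has the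
direction induced by the boundary of `t`, i.e. iff `-D⁰_{as} D¹_{st} = 1`. -/
def chain2 [Finite K.faces] (o : CellOrientation K) (a : Cell K 0) (w : SmallCell K 2) : ℝ :=
  ∑ s : Cell K 1, ∑ t : Cell K 2,
    if w.1 0 = a.1 ∧ w.1 1 = s.1 ∧ w.1 2 = t.1 then -(o.D0 a s * o.D1 s t) else 0

/-! ### Supports

A union of closed small triangles is represented by the set of these triangles. -/

/-- `U²_{⋆a}`, the closed dual cell of the node `a`. -/
def support2 (a : Cell K 0) : Set (SmallCell K 2) := {z | z.1 0 = a.1}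

/-- `U¹_{⋆s}`, the union of `U²_{⋆a}` over the dual cells `⋆a` having `⋆s` in their boundary. -/
def support1 (s : Cell K 1) : Set (SmallCell K 2) :=
  ⋃ a : {a : Cell K 0 // a.1 ⊆ s.1}, support2 a.1

/-- `U⁰_{⋆t}`, the union of `U¹_{⋆s}` over the dual edges `⋆s` having `⋆t` in their boundary. -/
def support0 (t : Cell K 2) : Set (SmallCell K 2) :=
  ⋃ s : {s : Cell K 1 // s.1 ⊆ t.1}, support1 s.1

/-- The small cell `w` is contained in the union of the closed small triangles in `U`. -/
def Inside {q : ℕ} (w : SmallCell K q) (U : Set (SmallCell K 2)) : Prop :=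
  ∃ z ∈ U, Set.range w.1 ⊆ Set.range z.1

/-- The small cell `w` is contained in the boundary of the union of the closed small triangles in
`U`: it is a face of a triangle in `U` and of a triangle not in `U`. -/
def OnBoundary {q : ℕ} (w : SmallCell K q) (U : Set (SmallCell K 2)) : Prop :=
  Inside w U ∧ Inside w Uᶜ

/-! ### The Buffa-Christiansen coefficients and 0-forms -/

/-- The coefficients `R^q_{vw}` of the basis forms `μ^q_v = ∑_w R^q_{vw} λ̃^q_w`, `q = 0, 1, 2`,
with `v = ⋆t` indexed by the primal cell `t`. -/
@[ext]
structure Coefficients (K : Geometry.SimplicialComplex ℝ E) where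
  R0 : Cell K 2 → SmallCell K 0 → ℝ
  R1 : Cell K 1 → SmallCell K 1 → ℝ
  R2 : Cell K 0 → SmallCell K 2 → ℝ

/-- The construction rules of the Buffa-Christiansen complex. -/
structure IsBuffaChristiansen [Finite K.faces] (o : CellOrientation K) (R : Coefficients K) :
    Prop where
  /-- Local support, with zero trace on the boundary of the support. -/
  local0 : ∀ t w, ¬ Inside w (support0 t) ∨ OnBoundary w (support0 t) → R.R0 t w = 0
  local1 : ∀ s w, ¬ Inside w (support1 s) ∨ OnBoundary w (support1 s) → R.R1 s w = 0
  local2 : ∀ a w, ¬ Inside w (support2 a) ∨ OnBoundary w (support2 a) → R.R2 a w = 0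
  /-- The small cells of a dual cell contribute to its basis form with the same weight. -/
  same0 : ∀ t w, chain0 t w ≠ 0 → R.R0 t w = 1 / (∑ w', |chain0 t w'|) * chain0 t w
  same1 : ∀ s w, chain1 o s w ≠ 0 → R.R1 s w = 1 / (∑ w', |chain1 o s w'|) * chain1 o s w
  same2 : ∀ a w, chain2 o a w ≠ 0 → R.R2 a w = 1 / (∑ w', |chain2 o a w'|) * chain2 o a w
  /-- The small edges contained in a primal edge `s` do not contribute to `μ¹_{⋆s}`. -/
  stable : ∀ (s : Cell K 1) (w : SmallCell K 1), w.1 1 ⊆ s.1 → R.R1 s w = 0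
  /-- The remaining 1-form coefficients: `dμ¹_{⋆s} = ∑_a D⁰_{as} μ²_{⋆a}` in the support. -/
  deriv1 : ∀ (s : Cell K 1) (z : SmallCell K 2), Inside z (support1 s) →
    ∑ w, R.R1 s w * smallD w z = ∑ a, o.D0 a s * R.R2 a z
  /-- The remaining 0-form coefficients: `dμ⁰_{⋆t} = -∑_s D¹_{st} μ¹_{⋆s}` in the support. -/
  deriv0 : ∀ (t : Cell K 2) (z : SmallCell K 1), Inside z (support0 t) →
    ∑ w, R.R0 t w * smallD w z = -∑ s, o.D1 s t * R.R1 s z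

/-- The barycentre of a cell. -/
def barycentre (σ : Finset E) : E := (σ.card : ℝ)⁻¹ • ∑ a ∈ σ, a

/-- `c` gives the barycentric coordinates of `x` with respect to the barycentric refinement: `x` is
a convex combination, with weights `c`, of barycentres of cells, and the cells with a nonzero weight
form a chain, i.e. they span a small simplex. -/
def IsRefinedCoords [Finite K.faces] (x : E) (c : SmallCell K 0 → ℝ) : Prop :=
  (∀ w, 0 ≤ c w) ∧ (∀ w w', c w ≠ 0 → c w' ≠ 0 → w.1 0 ⊆ w'.1 0 ∨ w'.1 0 ⊆ w.1 0) ∧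
    ∑ w, c w = 1 ∧ ∑ w, c w • barycentre (w.1 0) = x

/-- The standard Whitney 0-form `λ̃⁰_w` (hat function) of the barycentric refinement: the
barycentric coordinate at the node `w`. Every point of the surface has exactly one system of
barycentric coordinates, so that the choice is unambiguous. -/
def hat [Finite K.faces] (w : SmallCell K 0) (x : interface K) : ℝ :=
  if h : ∃ c : SmallCell K 0 → ℝ, IsRefinedCoords x.1 c then h.choose w else 0

/-- The 0-form `μ⁰_{⋆t} = ∑_w R⁰_{⋆t,w} λ̃⁰_w`, a function on the surface. -/
def Coefficients.zeroForm [Finite K.faces] (R : Coefficients K) (t : Cell K 2)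
    (x : interface K) : ℝ :=
  ∑ w, R.R0 t w * hat w x

end

end BuffaChristiansen

namespace BuffaChristiansen

open scoped Classical

variable {E : Type*} [AddCommGroup E] [Module ℝ E] {K : Geometry.SimplicialComplex ℝ E}

/-! ### Incidence numbers -/

/-! A small cell lies in the support of `⋆σ` and off its boundary exactly when its first cell is
contained in `σ` (`not_interior_iff`). The rules thereby become equations between cells
(`isBuffaChristiansen_iff`), and `R2` is forced to be `dual2`.

For the 1-form of `⋆s`, fix a node `a` of `s`. The unknowns are the values on the small edges from
`a` to the barycentres of the edges `s'` and facets `t` around `a`. The derivative rule on a flag `a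
⊂ s' ⊂ t` prescribes the difference of the values at `t` and `s'`. This is a difference equation on
the cycle around `a`: connectedness and the stability rule, which is zero at `s`, give uniqueness. A
solution exists iff the total circulation vanishes (`exists_star_potential`). It does: the two
halves of `⋆s` contribute `-D⁰_{as}`, and the equally weighted triangles of `⋆a` contribute
`+D⁰_{as}`.

For the 0-form of `⋆t`, the value one at the barycentre of `t` and the derivative rule along small
edges ending there fix all values. The rule on the other small edges follows from closedness of the
right-hand side, i.e. `D⁰D¹ = 0`, carried around each node of `t`.

Partition of unity: by coherence `∑_t D¹_{st} = 0`, so the sum over `t` of the coefficients does not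
change along a small edge. At the barycentre of a facet only one term survives, and it is one. The
hat functions sum to one as well. -/

lemma finset_pair_eq_pair_iff {α : Type*} {a b c d : α} :
    ({a, b} : Finset α) = {c, d} ↔ a = c ∧ b = d ∨ a = d ∧ b = c := by
  rw [← Finset.coe_inj]
  simp only [Finset.coe_pair]
  exact Set.pair_eq_pair_iff

namespace CellOrientation

variable (o : CellOrientation K)

lemma coe_edge (s : Cell K 1) : s.1 = {o.edge s 0, o.edge s 1} := by
  ext x
  rw [← Finset.mem_coe, ← o.range_edge s]
  simp [eq_comm]

lemma edge_ne (s : Cell K 1) : o.edge s 0 ≠ o.edge s 1 := by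
  intro h
  have h2 := s.2.2
  rw [o.coe_edge s, h] at h2
  simp at h2

lemma facet_injective (t : Cell K 2) : Function.Injective (o.facet t) := by
  have h2 := t.2.2
  have : t.1 = Finset.univ.image (o.facet t) := by
    ext x
    rw [← Finset.mem_coe, ← o.range_facet t]
    simp
  rw [this] at h2
  exact Set.injOn_univ.mp (by simpa using Finset.card_image_iff.mp (h2.trans (by simp)))

lemma facet_mem (t : Cell K 2) (i : Fin 3) : o.facet t i ∈ t.1 := by
  rw [← Finset.mem_coe, ← o.range_facet t]
  exact ⟨i, rfl⟩

lemma D0_eq_zero {a : Cell K 0} {s : Cell K 1} (h : ¬ a.1 ⊆ s.1) : o.D0 a s = 0 := by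
  have hs := o.coe_edge s
  have h1 : a.1 ≠ {o.edge s 1} := fun h' => h (by rw [h', hs]; simp)
  have h0 : a.1 ≠ {o.edge s 0} := fun h' => h (by rw [h', hs]; simp)
  simp [D0, h0, h1]

lemma D0_mul_self {a : Cell K 0} {s : Cell K 1} (h : a.1 ⊆ s.1) : o.D0 a s * o.D0 a s = 1 := by
  obtain ⟨p, hp⟩ := Finset.card_eq_one.mp a.2.2
  have hne := o.edge_ne s
  rw [o.coe_edge s, hp] at h
  simp only [Finset.singleton_subset_iff, Finset.mem_insert, Finset.mem_singleton] at h
  rcases h with rfl | rfl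
  · simp [D0, hp, hne]
  · simp [D0, hp, hne.symm]

lemma D1_eq_zero {s : Cell K 1} {t : Cell K 2} (h : ¬ s.1 ⊆ t.1) : o.D1 s t = 0 := by
  have hs := o.coe_edge s
  refine Finset.sum_eq_zero fun i _ => ?_
  rw [if_neg, if_neg, sub_zero]
  · rintro ⟨h1, h0⟩
    refine h ?_
    rw [hs, h0, h1]
    simp [Finset.insert_subset_iff, o.facet_mem]
  · rintro ⟨h1, h0⟩
    refine h ?_
    rw [hs, h0, h1]
    simp [Finset.insert_subset_iff, o.facet_mem]

lemma D1_mul_self {s : Cell K 1} {t : Cell K 2} (h : s.1 ⊆ t.1) : o.D1 s t * o.D1 s t = 1 := by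
  have hinj := o.facet_injective t
  have hne := o.edge_ne s
  have h0 : o.edge s 0 ∈ t.1 := h (by rw [o.coe_edge s]; simp)
  have h1 : o.edge s 1 ∈ t.1 := h (by rw [o.coe_edge s]; simp)
  rw [← Finset.mem_coe, ← o.range_facet t] at h0 h1
  obtain ⟨i, hi⟩ := h0
  obtain ⟨j, hj⟩ := h1
  unfold D1
  rw [← hi, ← hj] at hne ⊢
  rw [Fin.sum_univ_three]
  simp only [hinj.eq_iff]
  have hij : i ≠ j := fun h => hne (by rw [h])
  clear hi hj hne
  fin_cases i <;> fin_cases j <;> simp [Fin.ext_iff] at hij ⊢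

/-- Reversing the edge `s` changes the sign of both factors, so the product depends only on the
vertex set of `s` and on the side of `t` that it forms. -/
lemma D0_mul_D1 (a : Cell K 0) (s : Cell K 1) (t : Cell K 2) :
    o.D0 a s * o.D1 s t = ∑ i : Fin 3, if s.1 = {o.facet t i, o.facet t (i + 1)} then
      ((if a.1 = {o.facet t (i + 1)} then 1 else 0) - (if a.1 = {o.facet t i} then 1 else 0) : ℝ)
      else 0 := by
  unfold D1
  rw [Finset.mul_sum]
  refine Finset.sum_congr rfl fun i _ => ?_
  have hi : o.facet t i ≠ o.facet t (i + 1) := fun h => by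
    have := o.facet_injective t h
    fin_cases i <;> simp at this
  rw [o.coe_edge s]
  simp only [finset_pair_eq_pair_iff, D0]
  generalize o.facet t i = p at *
  generalize o.facet t (i + 1) = q at *
  by_cases h1 : o.edge s 0 = p ∧ o.edge s 1 = q
  · rw [h1.1, h1.2]
    simp [hi, hi.symm]
  · by_cases h2 : o.edge s 0 = q ∧ o.edge s 1 = p
    · rw [h2.1, h2.2]
      simp [hi, hi.symm]
    · have h3 : ¬ (o.edge s 1 = p ∧ o.edge s 0 = q) := fun h => h2 h.symm
      simp [h1, h2, h3]

/-- `D⁰ D¹ = 0`. -/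
lemma sum_D0_mul_D1 [Finite K.faces] (a : Cell K 0) (t : Cell K 2) :
    ∑ s, o.D0 a s * o.D1 s t = 0 := by
  simp_rw [o.D0_mul_D1]
  rw [Finset.sum_comm]
  have key : ∀ i : Fin 3, (∑ s : Cell K 1, if s.1 = {o.facet t i, o.facet t (i + 1)} then
      ((if a.1 = {o.facet t (i + 1)} then 1 else 0) - (if a.1 = {o.facet t i} then 1 else 0) : ℝ)
      else 0) =
      (if a.1 = {o.facet t (i + 1)} then 1 else 0) - (if a.1 = {o.facet t i} then 1 else 0) := by
    intro i
    have hi : o.facet t i ≠ o.facet t (i + 1) := fun h => by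
      have := o.facet_injective t h
      fin_cases i <;> simp at this
    let s : Cell K 1 := ⟨{o.facet t i, o.facet t (i + 1)},
      K.down_closed t.2.1 (by simp [Finset.insert_subset_iff, o.facet_mem]) (by simp),
      Finset.card_pair hi⟩
    rw [Finset.sum_eq_single s]
    · simp [s]
    · intro b _ hb
      rw [if_neg]
      exact fun h => hb (Subtype.ext h)
    · simp
  simp_rw [key]
  rw [Fin.sum_univ_three, show (0 + 1 : Fin 3) = 1 from rfl, show (1 + 1 : Fin 3) = 2 from rfl,
    show (2 + 1 : Fin 3) = 0 from rfl]
  ring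

end CellOrientation

lemma Cell.eq_of_subset {r : ℕ} {s t : Cell K r} (h : s.1 ⊆ t.1) : s = t :=
  Subtype.ext (Finset.eq_of_subset_of_card_le h (by rw [s.2.2, t.2.2]))

/-- A facet has exactly two edges at each of its nodes. -/
lemma exists_two_edges {a : Cell K 0} {t : Cell K 2} (h : a.1 ⊆ t.1) :
    ∃ s₁ s₂ : Cell K 1, s₁ ≠ s₂ ∧ ∀ s : Cell K 1, (a.1 ⊆ s.1 ∧ s.1 ⊆ t.1) ↔ s = s₁ ∨ s = s₂ := by
  obtain ⟨p, hp⟩ := Finset.card_eq_one.mp a.2.2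
  have hpt : p ∈ t.1 := h (by simp [hp])
  have hc : (t.1.erase p).card = 2 := by rw [Finset.card_erase_of_mem hpt, t.2.2]
  obtain ⟨q, r, hqr, he⟩ := Finset.card_eq_two.mp hc
  have ht : t.1 = {p, q, r} := by rw [← Finset.insert_erase hpt, he]
  have hq : q ∈ t.1.erase p := by simp [he]
  have hr : r ∈ t.1.erase p := by simp [he]
  have hqp := Finset.ne_of_mem_erase hq
  have hrp := Finset.ne_of_mem_erase hr
  refine ⟨⟨{p, q}, K.down_closed t.2.1 (by grind) (by simp), Finset.card_pair hqp.symm⟩,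
    ⟨{p, r}, K.down_closed t.2.1 (by grind) (by simp), Finset.card_pair hrp.symm⟩, ?_, ?_⟩
  · intro h'
    rw [Subtype.mk.injEq, finset_pair_eq_pair_iff] at h'
    rcases h' with ⟨-, h'⟩ | ⟨h', -⟩
    exacts [hqr h', hrp h'.symm]
  · intro s
    simp only [Subtype.ext_iff]
    constructor
    · rintro ⟨h1, h2⟩
      have hps : p ∈ s.1 := h1 (by simp [hp])
      obtain ⟨x, hx⟩ := Finset.card_eq_one.mp
        (show (s.1.erase p).card = 1 by rw [Finset.card_erase_of_mem hps, s.2.2])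
      have hs : s.1 = {p, x} := by rw [← Finset.insert_erase hps, hx]
      have hxe : x ∈ s.1.erase p := by simp [hx]
      have hxt : x ∈ t.1.erase p := by grind
      rw [he] at hxt
      rw [hs]
      grind
    · rintro (h' | h') <;> rw [h', hp, ht] <;> constructor <;> grind

/-! ### Edges and facets around a node -/

namespace IsClosedSurface

variable (hK : IsClosedSurface K)
include hK

lemma exists_two_facets (s : Cell K 1) :
    ∃ t₁ t₂ : Cell K 2, t₁ ≠ t₂ ∧ ∀ t : Cell K 2, s.1 ⊆ t.1 ↔ t = t₁ ∨ t = t₂ := by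
  obtain ⟨t₁, t₂, hne, h⟩ := Set.ncard_eq_two.mp (hK.two_facets s)
  refine ⟨t₁, t₂, hne, fun t => ?_⟩
  have := Set.ext_iff.mp h t
  simpa using this

/-- A property of the edges and facets at a node which passes from edges to adjacent facets and
back, and which holds somewhere, holds everywhere. -/
lemma star_induction (a : Cell K 0) {P : Cell K 1 → Prop} {Q : Cell K 2 → Prop}
    (h : ∀ s t, a.1 ⊆ s.1 → s.1 ⊆ t.1 → (P s ↔ Q t)) (s₀ : Cell K 1) (ha : a.1 ⊆ s₀.1)
    (h₀ : P s₀) : (∀ s, a.1 ⊆ s.1 → P s) ∧ ∀ t, a.1 ⊆ t.1 → Q t := by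
  obtain ⟨t₀, ht₀⟩ := hK.pure s₀.1 s₀.2.1
  have hQ : ∀ t, a.1 ⊆ t.1 → Q t := by
    intro t hat
    have := hK.star_connected a t₀ t (ha.trans ht₀) hat
    induction this with
    | refl => exact (h s₀ t₀ ha ht₀).mp h₀
    | tail _ h2 ih =>
      obtain ⟨s, has, hs1, hs2⟩ := h2
      exact (h s _ has hs2).mp ((h s _ has hs1).mpr (ih (has.trans hs1)))
  refine ⟨fun s has => ?_, hQ⟩
  obtain ⟨t, hst⟩ := hK.pure s.1 s.2.1
  exact (h s t has hst).mpr (hQ t (has.trans hst))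

variable [Finite K.faces] (o : CellOrientation K)

lemma sum_D1 (ho : o.IsCoherent) (s : Cell K 1) : ∑ t, o.D1 s t = 0 := by
  obtain ⟨t₁, t₂, hne, h⟩ := hK.exists_two_facets s
  rw [Fintype.sum_eq_add t₁ t₂ hne, ho s t₁ t₂ hne ((h _).mpr (.inl rfl)) ((h _).mpr (.inr rfl))]
  · simp
  · exact fun t ht => o.D1_eq_zero fun hs => by have := (h t).mp hs; tauto

lemma sum_D1_mul_self (s : Cell K 1) : ∑ t, o.D1 s t * o.D1 s t = 2 := by
  obtain ⟨t₁, t₂, hne, h⟩ := hK.exists_two_facets s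
  rw [Fintype.sum_eq_add t₁ t₂ hne, o.D1_mul_self ((h _).mpr (.inl rfl)),
    o.D1_mul_self ((h _).mpr (.inr rfl))]
  · norm_num
  · exact fun t ht => by
      rw [o.D1_eq_zero fun hs => by have := (h t).mp hs; tauto, mul_zero]

/-- A function on the flags at a node whose sums over the flags at each edge and at each facet
vanish is zero if it vanishes on one flag. -/
lemma star_function_eq_zero (a : Cell K 0) (d : Cell K 1 → Cell K 2 → ℝ)
    (hd : ∀ s t, ¬ (a.1 ⊆ s.1 ∧ s.1 ⊆ t.1) → d s t = 0)
    (hs : ∀ s, a.1 ⊆ s.1 → ∑ t, d s t = 0) (ht : ∀ t, a.1 ⊆ t.1 → ∑ s, d s t = 0)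
    {s₀ : Cell K 1} {t₀ : Cell K 2} (has : a.1 ⊆ s₀.1) (hst : s₀.1 ⊆ t₀.1) (h₀ : d s₀ t₀ = 0)
    (s : Cell K 1) (t : Cell K 2) : d s t = 0 := by
  -- The sum at an edge has only two possibly nonzero terms, so one zero forces the other. The same
  -- holds below for the two edges of a facet at `a`.
  have hs' : ∀ s, a.1 ⊆ s.1 → ∀ t, s.1 ⊆ t.1 → d s t = 0 → ∀ t', d s t' = 0 := by
    intro s has t hst h t'
    obtain ⟨t₁, t₂, hne, h2⟩ := hK.exists_two_facets s
    have hsum := hs s has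
    rw [Fintype.sum_eq_add t₁ t₂ hne (fun t ht => hd s t fun hf => by
      have := (h2 t).mp hf.2; tauto)] at hsum
    by_cases hst' : s.1 ⊆ t'.1
    · rcases (h2 t).mp hst with rfl | rfl <;> rcases (h2 t').mp hst' with rfl | rfl <;> linarith
    · exact hd _ _ fun hf => hst' hf.2
  have ht' : ∀ t, a.1 ⊆ t.1 → ∀ s, a.1 ⊆ s.1 → s.1 ⊆ t.1 → d s t = 0 → ∀ s', d s' t = 0 := by
    intro t hat s has hst h s'
    obtain ⟨s₁, s₂, hne, h2⟩ := exists_two_edges hat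
    have hsum := ht t hat
    rw [Fintype.sum_eq_add s₁ s₂ hne (fun s hs => hd s t fun hf => by
      have := (h2 s).mp hf; tauto)] at hsum
    by_cases hst' : a.1 ⊆ s'.1 ∧ s'.1 ⊆ t.1
    · rcases (h2 s).mp ⟨has, hst⟩ with rfl | rfl <;> rcases (h2 s').mp hst' with rfl | rfl <;>
        linarith
    · exact hd _ _ hst'
  have key := hK.star_induction a (P := fun s => ∀ t, d s t = 0) (Q := fun t => ∀ s, d s t = 0)
    (fun s t has hst => ⟨fun h => ht' t (has.trans hst) s has hst (h t),
      fun h => hs' s has t hst (h s)⟩) s₀ has (hs' s₀ has t₀ hst h₀)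
  by_cases has : a.1 ⊆ s.1
  · exact key.1 s has t
  · exact hd _ _ fun h => has h.1

/-- A 1-cochain on the link of a node with vanishing total circulation is exact. -/
lemma exists_star_potential (ho : o.IsCoherent) (a : Cell K 0) {s₀ : Cell K 1}
    (has : a.1 ⊆ s₀.1) (β : Cell K 1 → Cell K 2 → ℝ)
    (hβ : ∑ s, ∑ t, o.D0 a s * o.D1 s t * β s t = 0) :
    ∃ φ : Finset E → ℝ, φ s₀.1 = 0 ∧
      ∀ (s : Cell K 1) (t : Cell K 2), a.1 ⊆ s.1 → s.1 ⊆ t.1 → φ t.1 - φ s.1 = β s t := by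
  -- The coboundary of the link of `a`, extended by zero to pairs that are not flags at `a`. The
  -- claim is that `b` lies in its range.
  let A : (Finset E → ℝ) →ₗ[ℝ] (Cell K 1 × Cell K 2 → ℝ) :=
    { toFun := fun φ p => if a.1 ⊆ p.1.1 ∧ p.1.1 ⊆ p.2.1 then φ p.2.1 - φ p.1.1 else 0
      map_add' := fun φ ψ => by
        ext p
        simp only [Pi.add_apply]
        split_ifs <;> ring
      map_smul' := fun c φ => by
        ext p
        simp only [Pi.smul_apply, smul_eq_mul, RingHom.id_apply]
        split_ifs <;> ring }
  let b : Cell K 1 × Cell K 2 → ℝ :=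
    fun p => if a.1 ⊆ p.1.1 ∧ p.1.1 ⊆ p.2.1 then β p.1 p.2 else 0
  suffices hb : b ∈ LinearMap.range A by
    obtain ⟨φ, hφ⟩ := hb
    -- Potentials are only determined up to a constant, which is spent on the value at `s₀`.
    refine ⟨fun σ => φ σ - φ s₀.1, sub_self _, fun s t h1 h2 => ?_⟩
    have := congrFun hφ (s, t)
    simp only [A, b, LinearMap.coe_mk, AddHom.coe_mk, h1, h2, and_self, if_true] at this
    linarith
  by_contra hb
  -- Duality: a functional that kills the range of `A` but not `b`. Its coefficients `g` form a
  -- cycle on the link, hence a multiple of `D⁰D¹`, so its value at `b` is a multiple of the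
  -- circulation, which is zero.
  obtain ⟨ψ, hψb, hψ⟩ := Submodule.exists_le_ker_of_notMem hb
  have hexp : ∀ f : Cell K 1 × Cell K 2 → ℝ,
      ψ f = ∑ s, ∑ t, f (s, t) * ψ (Pi.single (s, t) 1) := by
    intro f
    conv_lhs => rw [pi_eq_sum_univ' f]
    rw [map_sum, Fintype.sum_prod_type]
    refine Finset.sum_congr rfl fun s _ => Finset.sum_congr rfl fun t _ => ?_
    rw [map_smul, smul_eq_mul]
  let g : Cell K 1 → Cell K 2 → ℝ :=
    fun s t => if a.1 ⊆ s.1 ∧ s.1 ⊆ t.1 then ψ (Pi.single (s, t) 1) else 0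
  have hA : ∀ φ : Finset E → ℝ, ∑ s : Cell K 1, ∑ t : Cell K 2, (φ t.1 - φ s.1) * g s t = 0 := by
    intro φ
    have h0 : ψ (A φ) = 0 := hψ ⟨φ, rfl⟩
    rw [hexp] at h0
    rw [← h0]
    refine Finset.sum_congr rfl fun s _ => Finset.sum_congr rfl fun t _ => ?_
    simp only [A, g, LinearMap.coe_mk, AddHom.coe_mk]
    split_ifs <;> simp
  have hne : ∀ (s : Cell K 1) (t : Cell K 2), s.1 ≠ t.1 := fun s t h => by
    have := s.2.2
    rw [h, t.2.2] at this
    omega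
  have hgs : ∀ s, ∑ t, g s t = 0 := by
    intro s
    have := hA (Pi.single s.1 1)
    rw [Finset.sum_eq_single s] at this
    · simpa [Pi.single_apply, (hne _ _).symm] using this
    · intro s' _ hs'
      simp [(hne _ _).symm, Subtype.val_injective.ne hs']
    · simp
  have hgt : ∀ t, ∑ s, g s t = 0 := by
    intro t
    have := hA (Pi.single t.1 1)
    rw [Finset.sum_comm, Finset.sum_eq_single t] at this
    · simpa [Pi.single_apply, hne] using this
    · intro s' _ hs'
      simp [hne, Subtype.val_injective.ne hs']
    · simp
  obtain ⟨t₀, ht₀⟩ := hK.pure s₀.1 s₀.2.1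
  -- Since `D⁰D¹` is a sign at this flag, this is the multiple of `D⁰D¹` that agrees with `g` there.
  set k := g s₀ t₀ * (o.D0 a s₀ * o.D1 s₀ t₀) with hk
  have hg : ∀ s t, g s t - k * (o.D0 a s * o.D1 s t) = 0 := by
    refine hK.star_function_eq_zero a (fun s t => g s t - k * (o.D0 a s * o.D1 s t)) ?_ ?_ ?_ has
      ht₀ ?_
    · intro s t hf
      have : o.D0 a s * o.D1 s t = 0 := by
        by_cases h1 : a.1 ⊆ s.1
        · rw [o.D1_eq_zero fun h => hf ⟨h1, h⟩, mul_zero]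
        · rw [o.D0_eq_zero h1, zero_mul]
      simp [g, hf, this]
    · intro s _
      rw [Finset.sum_sub_distrib, hgs, ← Finset.mul_sum, ← Finset.mul_sum, hK.sum_D1 o ho]
      simp
    · intro t _
      rw [Finset.sum_sub_distrib, hgt, ← Finset.mul_sum, o.sum_D0_mul_D1]
      simp
    · have h1 := o.D0_mul_self has
      have h2 := o.D1_mul_self ht₀
      rw [hk]
      linear_combination (- g s₀ t₀ * o.D1 s₀ t₀ * o.D1 s₀ t₀) * h1 - g s₀ t₀ * h2
  apply hψb
  rw [hexp]
  calc _ = ∑ s, ∑ t, k * (o.D0 a s * o.D1 s t * β s t) := by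
        refine Finset.sum_congr rfl fun s _ => Finset.sum_congr rfl fun t _ => ?_
        have := hg s t
        simp only [b, g] at this ⊢
        split_ifs with hf
        · rw [if_pos hf] at this
          linear_combination β s t * this
        · rw [if_neg hf] at this
          linear_combination β s t * this
    _ = 0 := by
        simp_rw [← Finset.mul_sum]
        rw [hβ, mul_zero]

end IsClosedSurface

/-! ### Small cells and supports -/

lemma SmallCell.nonempty {q : ℕ} (w : SmallCell K q) (i : Fin (q + 1)) : (w.1 i).Nonempty :=
  K.nonempty_of_mem_faces (w.2.2 i)

lemma SmallCell.zero_subset {q : ℕ} (w : SmallCell K q) (i : Fin (q + 1)) : w.1 0 ⊆ w.1 i :=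
  w.2.1.monotone (Fin.zero_le i)

/-- The small node at the barycentre of `σ`. -/
def smallNode {σ : Finset E} (h : σ ∈ K.faces) : SmallCell K 0 :=
  ⟨fun _ => σ, fun i j h => absurd h (by omega), fun _ => h⟩

/-- The small edge from the barycentre of `σ` to that of `τ`. -/
def smallEdge {σ τ : Finset E} (h : σ ⊂ τ) (hτ : σ ∈ K.faces ∧ τ ∈ K.faces) : SmallCell K 1 :=
  ⟨![σ, τ], by
    rw [Fin.strictMono_iff_lt_succ]
    intro i
    fin_cases i
    exact h, by
    intro i
    fin_cases i
    exacts [hτ.1, hτ.2]⟩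

lemma Cell.ssubset {r r' : ℕ} (h : r < r') {s : Cell K r} {t : Cell K r'} (hst : s.1 ⊆ t.1) :
    s.1 ⊂ t.1 := by
  refine Finset.ssubset_iff_subset_ne.mpr ⟨hst, fun he => ?_⟩
  have := s.2.2
  rw [he, t.2.2] at this
  omega

/-- The small triangle of a flag. -/
def smallTriangle {a : Cell K 0} {s : Cell K 1} {t : Cell K 2} (h : a.1 ⊆ s.1) (h' : s.1 ⊆ t.1) :
    SmallCell K 2 :=
  ⟨![a.1, s.1, t.1], by
    rw [Fin.strictMono_iff_lt_succ]
    intro i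
    fin_cases i
    · exact Cell.ssubset (by norm_num) h
    · exact Cell.ssubset (by norm_num) h', by
    intro i
    fin_cases i
    exacts [a.2.1, s.2.1, t.2.1]⟩

lemma support2_eq (a : Cell K 0) : support2 a = {z | z.1 0 ⊆ a.1} := by
  ext z
  refine ⟨fun h => h.subset, fun h => Finset.eq_of_subset_of_card_le h ?_⟩
  rw [a.2.2]
  exact (z.nonempty 0).card_pos

namespace IsClosedSurface

variable (hK : IsClosedSurface K)
include hK

/-- Three strictly increasing nonempty cells inside a facet must have one, two and three vertices.
-/
lemma exists_flag (z : SmallCell K 2) : ∃ (a : Cell K 0) (s : Cell K 1) (t : Cell K 2)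
    (h : a.1 ⊆ s.1) (h' : s.1 ⊆ t.1), z = smallTriangle h h' := by
  have h01 : z.1 0 ⊂ z.1 1 := z.2.1 (by decide)
  have h12 : z.1 1 ⊂ z.1 2 := z.2.1 (by decide)
  have c0 := (z.nonempty 0).card_pos
  have c1 := Finset.card_lt_card h01
  have c2 := Finset.card_lt_card h12
  obtain ⟨t, ht⟩ := hK.pure _ (z.2.2 2)
  have c3 := Finset.card_le_card ht
  rw [t.2.2] at c3
  refine ⟨⟨z.1 0, z.2.2 0, by omega⟩, ⟨z.1 1, z.2.2 1, by omega⟩, ⟨z.1 2, z.2.2 2, by omega⟩,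
    h01.subset, h12.subset, Subtype.ext (funext fun i => ?_)⟩
  fin_cases i <;> rfl

/-- Every small cell lies in a small triangle at any given vertex of its first cell. -/
lemma exists_triangle {q : ℕ} (w : SmallCell K q) {p : E} (hp : p ∈ w.1 0) :
    ∃ z : SmallCell K 2, z.1 0 = {p} ∧ Set.range w.1 ⊆ Set.range z.1 := by
  have hmono : Monotone w.1 := w.2.1.monotone
  have hpw : ∀ i, p ∈ w.1 i := fun i => w.zero_subset i hp
  obtain ⟨t, ht⟩ := hK.pure _ (w.2.2 (Fin.last q))
  have hwt : ∀ i, w.1 i ⊆ t.1 := fun i => (hmono (Fin.le_last i)).trans ht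
  -- The middle cell of the flag is the edge occurring in `w` if there is one, and otherwise any
  -- edge of `t` at `p`.
  have key : ∃ s : Cell K 1, p ∈ s.1 ∧ s.1 ⊆ t.1 ∧ ∀ i, (w.1 i).card = 2 → w.1 i = s.1 := by
    by_cases h : ∃ i, (w.1 i).card = 2
    · obtain ⟨i, hi⟩ := h
      refine ⟨⟨w.1 i, w.2.2 i, hi⟩, hpw i, hwt i, fun j hj => ?_⟩
      rcases le_total i j with h | h
      · exact (Finset.eq_of_subset_of_card_le (hmono h) (hj.trans hi.symm).le).symm
      · exact Finset.eq_of_subset_of_card_le (hmono h) (hi.trans hj.symm).le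
    · obtain ⟨s₁, _, _, h2⟩ := exists_two_edges (a := ⟨{p}, K.down_closed t.2.1
        (by simpa using hwt 0 hp) (by simp), by simp⟩) (t := t) (by simpa using hwt 0 hp)
      have := (h2 s₁).mpr (.inl rfl)
      exact ⟨s₁, by simpa using this.1, this.2, fun i hi => absurd ⟨i, hi⟩ h⟩
  obtain ⟨s, hps, hst, hs⟩ := key
  refine ⟨smallTriangle (a := ⟨{p}, K.down_closed t.2.1 (by simpa using hwt 0 hp) (by simp),
    by simp⟩) (s := s) (t := t) (by simpa using hps) hst, rfl, ?_⟩
  rintro _ ⟨i, rfl⟩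
  have c1 := (w.nonempty i).card_pos
  have c3 := Finset.card_le_card (hwt i)
  rw [t.2.2] at c3
  have : (w.1 i).card = 1 ∨ (w.1 i).card = 2 ∨ (w.1 i).card = 3 := by omega
  rcases this with h | h | h
  · refine ⟨0, ?_⟩
    exact Finset.eq_of_subset_of_card_le (Finset.singleton_subset_iff.mpr (hpw i)) h.le
  · exact ⟨1, (hs i h).symm⟩
  · refine ⟨2, ?_⟩
    exact (Finset.eq_of_subset_of_card_le (hwt i) (by rw [h, t.2.2])).symm

lemma support1_eq (s : Cell K 1) : support1 s = {z | z.1 0 ⊆ s.1} := by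
  ext z
  simp only [support1, Set.mem_iUnion, Set.mem_ofPred_eq, support2]
  constructor
  · rintro ⟨a, ha⟩
    exact ha ▸ a.2
  · intro h
    obtain ⟨a, s', t, h1, h2, rfl⟩ := hK.exists_flag z
    exact ⟨⟨a, h⟩, rfl⟩

lemma support0_eq (t : Cell K 2) : support0 t = {z | z.1 0 ⊆ t.1} := by
  ext z
  simp only [support0, Set.mem_iUnion, Set.mem_ofPred_eq, hK.support1_eq]
  constructor
  · rintro ⟨s, hs⟩
    exact hs.trans s.2
  · intro h
    obtain ⟨a, s', t, h1, h2, rfl⟩ := hK.exists_flag z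
    obtain ⟨s₁, _, _, h2⟩ := exists_two_edges (a := a) h
    have := (h2 s₁).mpr (.inl rfl)
    exact ⟨⟨s₁, this.2⟩, this.1⟩

lemma inside_iff {q : ℕ} (w : SmallCell K q) (σ : Finset E) :
    Inside w {z | z.1 0 ⊆ σ} ↔ ∃ p ∈ w.1 0, p ∈ σ := by
  constructor
  · rintro ⟨z, hz, hw⟩
    obtain ⟨p, hp⟩ := z.nonempty 0
    obtain ⟨i, hi⟩ := hw ⟨0, rfl⟩
    exact ⟨p, hi ▸ z.zero_subset i hp, hz hp⟩
  · rintro ⟨p, hp, hps⟩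
    obtain ⟨z, hz, hw⟩ := hK.exists_triangle w hp
    exact ⟨z, by simp [hz, hps], hw⟩

/-- The small cells in the support of a dual cell and not on its boundary. -/
lemma not_interior_iff {q : ℕ} (w : SmallCell K q) (σ : Finset E) :
    (¬ Inside w {z | z.1 0 ⊆ σ} ∨ OnBoundary w {z | z.1 0 ⊆ σ}) ↔ ¬ w.1 0 ⊆ σ := by
  constructor
  · rintro (h | ⟨-, z, hz, hw⟩) hσ
    · obtain ⟨p, hp⟩ := w.nonempty 0
      exact h ((hK.inside_iff w σ).mpr ⟨p, hp, hσ hp⟩)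
    · obtain ⟨i, hi⟩ := hw ⟨0, rfl⟩
      exact hz ((z.zero_subset i).trans (hi ▸ hσ))
  · intro h
    by_cases hi : Inside w {z | z.1 0 ⊆ σ}
    · obtain ⟨p, hp, hps⟩ := Finset.not_subset.mp h
      obtain ⟨z, hz, hw⟩ := hK.exists_triangle w hp
      exact .inr ⟨hi, z, by simp [hz, hps], hw⟩
    · exact .inl hi

lemma mem_small_edge (w : SmallCell K 1) :
    (∃ (s : Cell K 1) (t : Cell K 2), s.1 ⊆ t.1 ∧ w.1 0 = s.1 ∧ w.1 1 = t.1) ∨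
    (∃ (a : Cell K 0) (s : Cell K 1), a.1 ⊆ s.1 ∧ w.1 0 = a.1 ∧ w.1 1 = s.1) ∨
    ∃ (a : Cell K 0) (t : Cell K 2), a.1 ⊆ t.1 ∧ w.1 0 = a.1 ∧ w.1 1 = t.1 := by
  have h01 : w.1 0 ⊂ w.1 1 := w.2.1 (by decide)
  have c0 := (w.nonempty 0).card_pos
  have c1 := Finset.card_lt_card h01
  obtain ⟨t, ht⟩ := hK.pure _ (w.2.2 1)
  have c3 := Finset.card_le_card ht
  rw [t.2.2] at c3
  have : (w.1 0).card = 2 ∧ (w.1 1).card = 3 ∨ (w.1 0).card = 1 ∧ (w.1 1).card = 2 ∨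
    (w.1 0).card = 1 ∧ (w.1 1).card = 3 := by omega
  rcases this with h | h | h
  · exact .inl ⟨⟨_, w.2.2 0, h.1⟩, ⟨_, w.2.2 1, h.2⟩, h01.subset, rfl, rfl⟩
  · exact .inr (.inl ⟨⟨_, w.2.2 0, h.1⟩, ⟨_, w.2.2 1, h.2⟩, h01.subset, rfl, rfl⟩)
  · exact .inr (.inr ⟨⟨_, w.2.2 0, h.1⟩, ⟨_, w.2.2 1, h.2⟩, h01.subset, rfl, rfl⟩)

end IsClosedSurface

/-! ### Cochains as functions of cells -/

/-- A 0-cochain of the refinement as a function of a cell. -/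
noncomputable def onCell (f : SmallCell K 0 → ℝ) (σ : Finset E) : ℝ :=
  if h : σ ∈ K.faces then f (smallNode h) else 0

/-- A 1-cochain of the refinement as a function of two cells. -/
noncomputable def onPair (f : SmallCell K 1 → ℝ) (σ τ : Finset E) : ℝ :=
  if h : σ ⊂ τ ∧ (σ ∈ K.faces ∧ τ ∈ K.faces) then f (smallEdge h.1 h.2) else 0

lemma SmallCell.eq_of_zero {w w' : SmallCell K 0} (h : w.1 0 = w'.1 0) : w = w' :=
  Subtype.ext (funext fun i => by fin_cases i; exact h)

lemma SmallCell.eq_of_pair {w w' : SmallCell K 1} (h : w.1 0 = w'.1 0) (h' : w.1 1 = w'.1 1) :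
    w = w' :=
  Subtype.ext (funext fun i => by fin_cases i; exacts [h, h'])

lemma onCell_eq (f : SmallCell K 0 → ℝ) (w : SmallCell K 0) {σ : Finset E} (h : w.1 0 = σ) :
    onCell f σ = f w := by
  subst h
  rw [onCell, dif_pos (w.2.2 0)]
  exact congrArg f (SmallCell.eq_of_zero rfl)

lemma onPair_eq (f : SmallCell K 1 → ℝ) (w : SmallCell K 1) {σ τ : Finset E} (h : w.1 0 = σ)
    (h' : w.1 1 = τ) : onPair f σ τ = f w := by
  subst h
  subst h'
  rw [onPair, dif_pos ⟨w.2.1 (by decide), w.2.2 0, w.2.2 1⟩]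
  exact congrArg f (SmallCell.eq_of_pair rfl rfl)

lemma onCell_of_mem (f : SmallCell K 0 → ℝ) {σ : Finset E} (h : σ ∈ K.faces) :
    onCell f σ = f (smallNode h) :=
  dif_pos h

lemma onPair_of_ssubset (f : SmallCell K 1 → ℝ) {σ τ : Finset E} (h : σ ⊂ τ)
    (h' : σ ∈ K.faces ∧ τ ∈ K.faces) : onPair f σ τ = f (smallEdge h h') :=
  dif_pos ⟨h, h'⟩

/-- For each index `i`, exactly one small cell is the face of `z` omitting vertex `i`. -/
lemma sum_mul_smallD [Finite K.faces] {q : ℕ} (f : SmallCell K q → ℝ) (z : SmallCell K (q + 1)) :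
    ∑ w, f w * smallD w z = ∑ i : Fin (q + 2), (-1) ^ (i : ℕ) *
      f ⟨z.1 ∘ i.succAbove, z.2.1.comp (Fin.strictMono_succAbove i), fun _ => z.2.2 _⟩ := by
  simp_rw [smallD, Finset.mul_sum]
  rw [Finset.sum_comm]
  refine Finset.sum_congr rfl fun i _ => ?_
  rw [Finset.sum_eq_single
    ⟨z.1 ∘ i.succAbove, z.2.1.comp (Fin.strictMono_succAbove i), fun _ => z.2.2 _⟩]
  · rw [if_pos rfl, mul_comm]
  · intro w _ hw
    rw [if_neg, mul_zero]
    exact fun h => hw (Subtype.ext h)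
  · simp

lemma sum_mul_smallD_edge [Finite K.faces] (f : SmallCell K 0 → ℝ) (z : SmallCell K 1) :
    ∑ w, f w * smallD w z = onCell f (z.1 1) - onCell f (z.1 0) := by
  rw [sum_mul_smallD, Fin.sum_univ_two, ← onCell_eq f _ rfl, ← onCell_eq f _ rfl]
  simp [sub_eq_add_neg]

lemma sum_mul_smallD_triangle [Finite K.faces] (f : SmallCell K 1 → ℝ) (z : SmallCell K 2) :
    ∑ w, f w * smallD w z =
      onPair f (z.1 1) (z.1 2) - onPair f (z.1 0) (z.1 2) + onPair f (z.1 0) (z.1 1) := by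
  rw [sum_mul_smallD, Fin.sum_univ_three, ← onPair_eq f _ rfl rfl, ← onPair_eq f _ rfl rfl,
    ← onPair_eq f _ rfl rfl]
  simp [sub_eq_add_neg, Fin.succAbove, Fin.lt_def]

/-! ### Chains -/

lemma chain0_eq (t : Cell K 2) (w : SmallCell K 0) (h : w.1 0 = t.1) : chain0 t w = 1 := if_pos h

lemma CellOrientation.abs_D1 (o : CellOrientation K) (s : Cell K 1) (t : Cell K 2) :
    |o.D1 s t| = o.D1 s t * o.D1 s t := by
  by_cases h : s.1 ⊆ t.1
  · have := o.D1_mul_self h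
    rw [this]
    rcases mul_self_eq_one_iff.mp this with h | h <;> simp [h]
  · simp [o.D1_eq_zero h]

variable [Finite K.faces]

lemma sum_abs_chain0 (t : Cell K 2) : ∑ w, |chain0 t w| = 1 := by
  rw [Finset.sum_eq_single (smallNode t.2.1)]
  · simp [chain0, smallNode]
  · intro w _ hw
    rw [chain0, if_neg, abs_zero]
    exact fun h => hw (SmallCell.eq_of_zero h)
  · simp

namespace CellOrientation

variable (o : CellOrientation K)

lemma chain1_eq {s : Cell K 1} {t : Cell K 2} {w : SmallCell K 1} (h : w.1 0 = s.1)
    (h' : w.1 1 = t.1) : chain1 o s w = -o.D1 s t := by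
  rw [chain1, Finset.sum_eq_single t]
  · simp [h, h']
  · intro t' _ ht
    rw [if_neg]
    exact fun h2 => ht (Subtype.ext (h2.2.symm.trans h'))
  · simp

lemma chain1_eq_zero {s : Cell K 1} {w : SmallCell K 1} (h : w.1 0 ≠ s.1) : chain1 o s w = 0 :=
  Finset.sum_eq_zero fun _ _ => if_neg fun h' => h h'.1

lemma chain2_eq {a : Cell K 0} {s : Cell K 1} {t : Cell K 2} {w : SmallCell K 2}
    (h : w.1 0 = a.1) (h' : w.1 1 = s.1) (h'' : w.1 2 = t.1) :
    chain2 o a w = -(o.D0 a s * o.D1 s t) := by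
  rw [chain2, Finset.sum_eq_single s, Finset.sum_eq_single t]
  · simp [h, h', h'']
  · intro t' _ ht
    rw [if_neg]
    exact fun h2 => ht (Subtype.ext (h2.2.2.symm.trans h''))
  · simp
  · intro s' _ hs
    refine Finset.sum_eq_zero fun t' _ => ?_
    rw [if_neg]
    exact fun h2 => hs (Subtype.ext (h2.2.1.symm.trans h'))
  · simp

lemma chain2_eq_zero {a : Cell K 0} {w : SmallCell K 2} (h : w.1 0 ≠ a.1) : chain2 o a w = 0 :=
  Finset.sum_eq_zero fun _ _ => Finset.sum_eq_zero fun _ _ => if_neg fun h' => h h'.1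

end CellOrientation

namespace IsClosedSurface

variable (hK : IsClosedSurface K) (o : CellOrientation K)
include hK

lemma sum_abs_chain1 (s : Cell K 1) : ∑ w, |chain1 o s w| = 2 := by
  rw [← hK.sum_D1_mul_self o s]
  obtain ⟨t₁, t₂, hne, h⟩ := hK.exists_two_facets s
  have h1 := (h t₁).mpr (.inl rfl)
  have h2 := (h t₂).mpr (.inr rfl)
  let w₁ : SmallCell K 1 := smallEdge (Cell.ssubset (by norm_num) h1) ⟨s.2.1, t₁.2.1⟩
  let w₂ : SmallCell K 1 := smallEdge (Cell.ssubset (by norm_num) h2) ⟨s.2.1, t₂.2.1⟩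
  have hw : w₁ ≠ w₂ := fun h => hne (Subtype.ext (congrFun (congrArg Subtype.val h) 1))
  rw [Fintype.sum_eq_add w₁ w₂ hw, Fintype.sum_eq_add t₁ t₂ hne]
  · rw [o.chain1_eq (s := s) (t := t₁) rfl rfl, o.chain1_eq (s := s) (t := t₂) rfl rfl]
    simp [o.abs_D1]
  · intro t ht
    rw [o.D1_eq_zero fun hs => by have := (h t).mp hs; tauto, mul_zero]
  · intro w hw
    by_cases h0 : w.1 0 = s.1
    · exfalso
      rcases hK.mem_small_edge w with ⟨s', t', h', e0, e1⟩ | ⟨a, s', h', e0, e1⟩ | ⟨a, t', h', e0, e1⟩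
      · rw [h0] at e0
        rcases (h t').mp (e0 ▸ h') with rfl | rfl
        · exact hw.1 (SmallCell.eq_of_pair h0 e1)
        · exact hw.2 (SmallCell.eq_of_pair h0 e1)
      · have := s.2.2
        rw [← h0, e0, a.2.2] at this
        omega
      · have := s.2.2
        rw [← h0, e0, a.2.2] at this
        omega
    · rw [o.chain1_eq_zero h0, abs_zero]

/-- The nonzero terms are the flags at `a`, each with coefficient a sign. The sum of squares is the
form in which this number appears in the circulation around `a`. -/
lemma sum_abs_chain2 (a : Cell K 0) :
    ∑ w, |chain2 o a w| = ∑ s, ∑ t, (o.D0 a s * o.D1 s t) * (o.D0 a s * o.D1 s t) := by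
  have habs : ∀ (s : Cell K 1) (t : Cell K 2), a.1 ⊆ s.1 → s.1 ⊆ t.1 →
      |(o.D0 a s * o.D1 s t)| = (o.D0 a s * o.D1 s t) * (o.D0 a s * o.D1 s t) := by
    intro s t h h'
    have h1 := o.D0_mul_self h
    have h2 := o.D1_mul_self h'
    have h3 : (o.D0 a s * o.D1 s t) * (o.D0 a s * o.D1 s t) = 1 := by
      linear_combination o.D1 s t * o.D1 s t * h1 + h2
    rw [h3]
    rcases mul_self_eq_one_iff.mp h3 with h | h <;> simp [h]
  rw [← Fintype.sum_prod_type' (f := fun s t => (o.D0 a s * o.D1 s t) * (o.D0 a s * o.D1 s t))]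
  have hf : ∀ p : Cell K 1 × Cell K 2,
      (o.D0 a p.1 * o.D1 p.1 p.2) * (o.D0 a p.1 * o.D1 p.1 p.2) ≠ 0 →
      a.1 ⊆ p.1.1 ∧ p.1.1 ⊆ p.2.1 := by
    intro p hp
    constructor
    · by_contra h
      simp [o.D0_eq_zero h] at hp
    · by_contra h
      simp [o.D1_eq_zero h] at hp
  symm
  refine Finset.sum_bij_ne_zero (fun p _ hp => smallTriangle (hf p hp).1 (hf p hp).2)
    (fun _ _ _ => Finset.mem_univ _) ?_ ?_ ?_
  · intro p _ _ p' _ _ h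
    exact Prod.ext (Subtype.ext (congrFun (congrArg Subtype.val h) 1))
      (Subtype.ext (congrFun (congrArg Subtype.val h) 2))
  · intro w _ hw
    obtain ⟨a', s, t, h, h', rfl⟩ := hK.exists_flag w
    obtain rfl : a' = a := by
      by_contra hne
      exact hw (by rw [o.chain2_eq_zero fun h => hne (Subtype.ext h), abs_zero])
    rw [o.chain2_eq (s := s) (t := t) rfl rfl rfl, abs_neg, habs s t h h'] at hw
    exact ⟨(s, t), Finset.mem_univ _, hw, rfl⟩
  · intro p _ hp
    rw [o.chain2_eq (s := p.1) (t := p.2) rfl rfl rfl, abs_neg, habs _ _ (hf p hp).1 (hf p hp).2]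

end IsClosedSurface

/-! ### The construction rules, rewritten -/

/-- The only admissible 2-form coefficients. -/
noncomputable def dual2 (o : CellOrientation K) (a : Cell K 0) (w : SmallCell K 2) : ℝ :=
  1 / (∑ w', |chain2 o a w'|) * chain2 o a w

/-- The rules for the 1-form coefficients, with the supports made explicit. -/
structure IsDual1 (o : CellOrientation K) (R : Cell K 1 → SmallCell K 1 → ℝ) : Prop where
  support : ∀ s w, ¬ w.1 0 ⊆ s.1 → R s w = 0
  dual : ∀ (s : Cell K 1) (t : Cell K 2) w, w.1 0 = s.1 → w.1 1 = t.1 → R s w = -o.D1 s t / 2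
  stable : ∀ (s : Cell K 1) (w : SmallCell K 1), w.1 1 ⊆ s.1 → R s w = 0
  deriv : ∀ (s : Cell K 1) (z : SmallCell K 2), z.1 0 ⊆ s.1 →
    onPair (R s) (z.1 1) (z.1 2) - onPair (R s) (z.1 0) (z.1 2) + onPair (R s) (z.1 0) (z.1 1) =
      ∑ a, o.D0 a s * dual2 o a z

/-- The rules for the 0-form coefficients, with the supports made explicit. -/
structure IsDual0 (o : CellOrientation K) (R₁ : Cell K 1 → SmallCell K 1 → ℝ)
    (R : Cell K 2 → SmallCell K 0 → ℝ) : Prop where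
  support : ∀ t w, ¬ w.1 0 ⊆ t.1 → R t w = 0
  dual : ∀ t w, w.1 0 = t.1 → R t w = 1
  deriv : ∀ (t : Cell K 2) (z : SmallCell K 1), (∃ p ∈ z.1 0, p ∈ t.1) →
    onCell (R t) (z.1 1) - onCell (R t) (z.1 0) = -∑ s, o.D1 s t * R₁ s z

namespace IsClosedSurface

variable (hK : IsClosedSurface K) (o : CellOrientation K)
include hK

/-- The weights are made explicit as well: a dual edge has two halves and a dual node a single
point, which gives the values `-D¹/2` and `1`. -/
lemma isBuffaChristiansen_iff (R : Coefficients K) :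
    IsBuffaChristiansen o R ↔ R.R2 = dual2 o ∧ IsDual1 o R.R1 ∧ IsDual0 o R.R1 R.R0 := by
  -- A small triangle starts at a single node, so meeting `s` and being contained in `s` coincide.
  -- For small edges, as in the 0-form rule, they differ.
  have hz : ∀ (s : Cell K 1) (z : SmallCell K 2), (∃ p ∈ z.1 0, p ∈ s.1) ↔ z.1 0 ⊆ s.1 := by
    intro s z
    obtain ⟨a, s', t, h, h', rfl⟩ := hK.exists_flag z
    obtain ⟨x, hx⟩ := Finset.card_eq_one.mp a.2.2
    simp [smallTriangle, hx]
  constructor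
  · intro h
    have h2 : R.R2 = dual2 o := by
      ext a w
      by_cases haw : w.1 0 = a.1
      · refine h.same2 a w ?_
        obtain ⟨a', s, t, h1, h2, rfl⟩ := hK.exists_flag w
        obtain rfl : a' = a := Subtype.ext haw
        rw [o.chain2_eq (s := s) (t := t) rfl rfl rfl]
        refine neg_ne_zero.mpr (mul_ne_zero (fun h0 => ?_) fun h0 => ?_)
        · simpa [h0] using o.D0_mul_self h1
        · simpa [h0] using o.D1_mul_self h2
      · rw [dual2, o.chain2_eq_zero haw, mul_zero]
        refine h.local2 a w ?_
        rw [support2_eq, hK.not_interior_iff]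
        exact fun hs => haw (Finset.eq_of_subset_of_card_le hs
          (by rw [a.2.2]; exact (w.nonempty 0).card_pos))
    refine ⟨h2, ⟨fun s w hw => h.local1 s w ?_, fun s t w h0 h1 => ?_, h.stable,
      fun s z hs => ?_⟩, fun t w hw => h.local0 t w ?_, fun t w hw => ?_, fun t z hz => ?_⟩
    · rwa [hK.support1_eq, hK.not_interior_iff]
    · rw [h.same1 s w, hK.sum_abs_chain1, o.chain1_eq h0 h1]
      · ring
      · rw [o.chain1_eq h0 h1, neg_ne_zero]
        intro hD
        have hst : s.1 ⊆ t.1 := h0 ▸ h1 ▸ w.zero_subset 1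
        simpa [hD] using o.D1_mul_self hst
    · rw [← sum_mul_smallD_triangle, ← h2]
      refine h.deriv1 s z ?_
      rwa [hK.support1_eq, hK.inside_iff, hz]
    · rwa [hK.support0_eq, hK.not_interior_iff]
    · rw [h.same0 t w (by simp [chain0_eq t w hw]), sum_abs_chain0, chain0_eq t w hw]
      norm_num
    · rw [← sum_mul_smallD_edge]
      refine h.deriv0 t z ?_
      rwa [hK.support0_eq, hK.inside_iff]
  · rintro ⟨h2, h1, h0⟩
    refine ⟨fun t w => ?_, fun s w => ?_, fun a w => ?_, fun t w hw => ?_, fun s w hw => ?_,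
      fun a w _ => ?_, h1.stable, fun s z => ?_, fun t z => ?_⟩
    · rw [hK.support0_eq, hK.not_interior_iff]
      exact h0.support t w
    · rw [hK.support1_eq, hK.not_interior_iff]
      exact h1.support s w
    · rw [support2_eq, hK.not_interior_iff, h2]
      intro h
      rw [dual2, o.chain2_eq_zero fun h' => h h'.subset, mul_zero]
    · rw [sum_abs_chain0]
      have : w.1 0 = t.1 := by
        by_contra h
        exact hw (if_neg h)
      rw [h0.dual t w this, chain0_eq t w this]
      norm_num
    · obtain ⟨t, -, ht⟩ := Finset.exists_ne_zero_of_sum_ne_zero hw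
      obtain ⟨e0, e1⟩ : w.1 0 = s.1 ∧ w.1 1 = t.1 := by
        by_contra h
        exact ht (if_neg h)
      rw [h1.dual s t w e0 e1, hK.sum_abs_chain1, o.chain1_eq e0 e1]
      ring
    · rw [h2, dual2]
    · rw [hK.support1_eq, hK.inside_iff, hz, sum_mul_smallD_triangle, h2]
      exact h1.deriv s z
    · rw [hK.support0_eq, hK.inside_iff, sum_mul_smallD_edge]
      exact h0.deriv t z

omit hK in
lemma dual2_eq_zero {a : Cell K 0} {z : SmallCell K 2} (h : z.1 0 ≠ a.1) : dual2 o a z = 0 := by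
  rw [dual2, o.chain2_eq_zero h, mul_zero]

omit hK in
lemma sum_D0_mul_dual2 (s : Cell K 1) {a : Cell K 0} {s' : Cell K 1} {t : Cell K 2}
    (h : a.1 ⊆ s'.1) (h' : s'.1 ⊆ t.1) :
    ∑ b, o.D0 b s * dual2 o b (smallTriangle h h') =
      -(o.D0 a s * (o.D0 a s' * o.D1 s' t) / ∑ w', |chain2 o a w'|) := by
  rw [Finset.sum_eq_single a]
  · rw [dual2, o.chain2_eq (s := s') (t := t) rfl rfl rfl]
    ring
  · intro b _ hb
    rw [dual2_eq_zero o (fun h => hb (Subtype.ext h.symm)), mul_zero]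
  · simp

/-! ### The 1-form coefficients -/

omit hK in
lemma IsDual1.onPair_eq_zero {R : Cell K 1 → SmallCell K 1 → ℝ} (hR : IsDual1 o R) {s : Cell K 1}
    {σ : Finset E} (τ : Finset E) (h : ¬ σ ⊆ s.1) : onPair (R s) σ τ = 0 := by
  unfold onPair
  split_ifs with h'
  · exact hR.support s _ h
  · rfl

omit hK in
lemma IsDual1.onPair_edge {R : Cell K 1 → SmallCell K 1 → ℝ} (hR : IsDual1 o R) (s : Cell K 1)
    {s' : Cell K 1} {t : Cell K 2} (h : s'.1 ⊆ t.1) :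
    onPair (R s) s'.1 t.1 = if s' = s then -o.D1 s t / 2 else 0 := by
  split_ifs with hs
  · subst hs
    rw [onPair_of_ssubset _ (Cell.ssubset (by norm_num) h) ⟨s'.2.1, t.2.1⟩]
    exact hR.dual _ _ _ rfl rfl
  · exact IsDual1.onPair_eq_zero o hR _ fun h => hs (Cell.eq_of_subset h)

/-- `dμ¹ = D⁰ μ²` holds on the whole surface. -/
lemma IsDual1.deriv_all {R : Cell K 1 → SmallCell K 1 → ℝ} (hR : IsDual1 o R) (s : Cell K 1)
    (z : SmallCell K 2) :
    onPair (R s) (z.1 1) (z.1 2) - onPair (R s) (z.1 0) (z.1 2) + onPair (R s) (z.1 0) (z.1 1) =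
      ∑ a, o.D0 a s * dual2 o a z := by
  by_cases h : z.1 0 ⊆ s.1
  · exact hR.deriv s z h
  · have h1 : ¬ z.1 1 ⊆ s.1 := fun h' => h ((z.zero_subset 1).trans h')
    rw [IsDual1.onPair_eq_zero o hR _ h, IsDual1.onPair_eq_zero o hR _ h,
      IsDual1.onPair_eq_zero o hR _ h1]
    obtain ⟨a, s', t, h2, h3, rfl⟩ := hK.exists_flag z
    rw [sum_D0_mul_dual2, o.D0_eq_zero h]
    simp

/-- Around a node of `s`, the derivative rule carries agreement of two solutions from one small edge
to the next. The stability rule starts this at the small edge lying in `s`. -/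
lemma isDual1_unique {R R' : Cell K 1 → SmallCell K 1 → ℝ} (hR : IsDual1 o R)
    (hR' : IsDual1 o R') : R = R' := by
  ext s w
  by_cases hws : w.1 0 ⊆ s.1
  swap
  · rw [hR.support s w hws, hR'.support s w hws]
  have key : ∀ a : Cell K 0, a.1 ⊆ s.1 →
      (∀ s' : Cell K 1, a.1 ⊆ s'.1 → onPair (R s) a.1 s'.1 = onPair (R' s) a.1 s'.1) ∧
      ∀ t : Cell K 2, a.1 ⊆ t.1 → onPair (R s) a.1 t.1 = onPair (R' s) a.1 t.1 := by
    intro a ha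
    refine hK.star_induction a (fun s' t h h' => ?_) s ha ?_
    · have e := hR.deriv s (smallTriangle h h') ha
      rw [← hR'.deriv s (smallTriangle h h') ha] at e
      change onPair (R s) s'.1 t.1 - onPair (R s) a.1 t.1 + onPair (R s) a.1 s'.1 =
        onPair (R' s) s'.1 t.1 - onPair (R' s) a.1 t.1 + onPair (R' s) a.1 s'.1 at e
      rw [IsDual1.onPair_edge o hR s h', IsDual1.onPair_edge o hR' s h'] at e
      constructor <;> intro <;> linarith
    · rw [onPair_of_ssubset _ (Cell.ssubset (by norm_num) ha) ⟨a.2.1, s.2.1⟩,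
        onPair_of_ssubset _ (Cell.ssubset (by norm_num) ha) ⟨a.2.1, s.2.1⟩,
        hR.stable _ _ subset_rfl, hR'.stable _ _ subset_rfl]
  rcases hK.mem_small_edge w with ⟨s', t, h, e0, e1⟩ | ⟨a, s', h, e0, e1⟩ | ⟨a, t, h, e0, e1⟩
  · obtain rfl : s' = s := Cell.eq_of_subset (e0 ▸ hws)
    rw [hR.dual _ t w e0 e1, hR'.dual _ t w e0 e1]
  · rw [← onPair_eq (R s) w e0 e1, ← onPair_eq (R' s) w e0 e1]
    exact (key a (e0 ▸ hws)).1 s' h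
  · rw [← onPair_eq (R s) w e0 e1, ← onPair_eq (R' s) w e0 e1]
    exact (key a (e0 ▸ hws)).2 t h

/-- The two nodes of `s` are treated independently, each by a potential on its star normalised to
zero at `s`. -/
lemma exists_isDual1 (ho : o.IsCoherent) : ∃ R, IsDual1 o R := by
  -- Quantifying over all finite sets `α` lets the chosen potential be evaluated directly at the
  -- first cell of a small edge.
  have hpot : ∀ (α : Finset E) (s : Cell K 1), ∃ φ : Finset E → ℝ, ∀ a : Cell K 0, a.1 = α →
      a.1 ⊆ s.1 → φ s.1 = 0 ∧ ∀ (s' : Cell K 1) (t : Cell K 2), a.1 ⊆ s'.1 → s'.1 ⊆ t.1 →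
      φ t.1 - φ s'.1 = (if s' = s then -o.D1 s t / 2 else 0) +
        o.D0 a s * (o.D0 a s' * o.D1 s' t) / ∑ w', |chain2 o a w'| := by
    intro α s
    by_cases h : ∃ a : Cell K 0, a.1 = α ∧ a.1 ⊆ s.1
    swap
    · exact ⟨0, fun a h1 h2 => absurd ⟨a, h1, h2⟩ h⟩
    obtain ⟨a, rfl, has⟩ := h
    have h0 := o.D0_mul_self has
    have hn : ∑ w', |chain2 o a w'| ≠ 0 := by
      rw [hK.sum_abs_chain2]
      refine ne_of_gt ?_
      obtain ⟨t, hst⟩ := hK.pure s.1 s.2.1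
      have h1 := o.D1_mul_self hst
      refine Finset.sum_pos' (fun _ _ => Finset.sum_nonneg fun _ _ => mul_self_nonneg _)
        ⟨s, Finset.mem_univ _, Finset.sum_pos' (fun _ _ => mul_self_nonneg _)
          ⟨t, Finset.mem_univ _, ?_⟩⟩
      have : (o.D0 a s * o.D1 s t) * (o.D0 a s * o.D1 s t) = 1 := by
        linear_combination o.D1 s t * o.D1 s t * h0 + h1
      rw [this]
      exact one_pos
    obtain ⟨φ, hφ, hφ'⟩ := hK.exists_star_potential o ho a has
      (fun s' t => (if s' = s then -o.D1 s t / 2 else 0) +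
        o.D0 a s * (o.D0 a s' * o.D1 s' t) / ∑ w', |chain2 o a w'|) (by
      simp_rw [mul_add, Finset.sum_add_distrib]
      -- The circulation splits into the part from the two halves of `⋆s` and the part from the
      -- triangles of `⋆a`; they cancel.
      have e1 : ∑ s', ∑ t, o.D0 a s' * o.D1 s' t * (if s' = s then -o.D1 s t / 2 else 0) =
          -o.D0 a s := by
        rw [Finset.sum_eq_single s]
        · simp only [if_true]
          calc _ = ∑ t, -(o.D0 a s / 2) * (o.D1 s t * o.D1 s t) :=
                Finset.sum_congr rfl fun _ _ => by ring
            _ = _ := by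
                rw [← Finset.mul_sum, hK.sum_D1_mul_self]
                ring
        · intro b _ hb
          simp [hb]
        · simp
      have e2 : ∑ s', ∑ t, o.D0 a s' * o.D1 s' t *
          (o.D0 a s * (o.D0 a s' * o.D1 s' t) / ∑ w', |chain2 o a w'|) = o.D0 a s := by
        calc _ = ∑ s', ∑ t, o.D0 a s / (∑ w', |chain2 o a w'|) *
                ((o.D0 a s' * o.D1 s' t) * (o.D0 a s' * o.D1 s' t)) :=
              Finset.sum_congr rfl fun _ _ => Finset.sum_congr rfl fun _ _ => by ring
          _ = _ := by
              simp_rw [← Finset.mul_sum]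
              rw [← hK.sum_abs_chain2, div_mul_cancel₀ _ hn]
      rw [e1, e2]
      ring)
    refine ⟨φ, fun b hb _ => ?_⟩
    obtain rfl : b = a := Subtype.ext hb
    exact ⟨hφ, hφ'⟩
  choose φ hφ using hpot
  let R : Cell K 1 → SmallCell K 1 → ℝ := fun s w =>
    if w.1 0 = s.1 then chain1 o s w / 2 else if w.1 0 ⊆ s.1 then φ (w.1 0) s (w.1 1) else 0
  have hne : ∀ (a : Cell K 0) (s : Cell K 1), a.1 ≠ s.1 := fun a s h => by
    have := a.2.2
    rw [h, s.2.2] at this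
    omega
  have hRa : ∀ (s : Cell K 1) (a : Cell K 0) (τ : Finset E), a.1 ⊆ s.1 → a.1 ⊂ τ → τ ∈ K.faces →
      onPair (R s) a.1 τ = φ a.1 s τ := by
    intro s a τ h h' hτ
    rw [onPair_of_ssubset _ h' ⟨a.2.1, hτ⟩]
    change (if a.1 = s.1 then _ else if a.1 ⊆ s.1 then φ a.1 s τ else 0) = _
    rw [if_neg (hne a s), if_pos h]
  refine ⟨R, fun s w hw => ?_, fun s t w h0 h1 => ?_, fun s w hw => ?_, fun s z hz => ?_⟩
  · simp only [R]
    rw [if_neg fun h => hw h.subset, if_neg hw]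
  · simp only [R]
    rw [if_pos h0, o.chain1_eq h0 h1]
  · simp only [R]
    rcases hK.mem_small_edge w with ⟨s', t, h, e0, e1⟩ | ⟨a, s', h, e0, e1⟩ | ⟨a, t, h, e0, e1⟩
    · have := Finset.card_le_card hw
      rw [e1, t.2.2, s.2.2] at this
      omega
    · obtain rfl : s' = s := Cell.eq_of_subset (e1 ▸ hw)
      rw [e0, e1, if_neg (hne a s'), if_pos h]
      exact (hφ a.1 s' a rfl h).1
    · have := Finset.card_le_card hw
      rw [e1, t.2.2, s.2.2] at this
      omega
  · obtain ⟨a, s', t, h, h', rfl⟩ := hK.exists_flag z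
    rw [sum_D0_mul_dual2]
    change onPair (R s) s'.1 t.1 - onPair (R s) a.1 t.1 + onPair (R s) a.1 s'.1 = _
    rw [hRa s a _ hz (Cell.ssubset (by norm_num) h) s'.2.1,
      hRa s a _ hz (Cell.ssubset (by norm_num) (h.trans h')) t.2.1]
    have e := (hφ a.1 s a rfl hz).2 s' t h h'
    have e' : onPair (R s) s'.1 t.1 = if s' = s then -o.D1 s t / 2 else 0 := by
      rw [onPair_of_ssubset _ (Cell.ssubset (by norm_num) h') ⟨s'.2.1, t.2.1⟩]
      split_ifs with hs
      · subst hs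
        change (if s'.1 = s'.1 then _ else _) = _
        rw [if_pos rfl, o.chain1_eq (s := s') (t := t) rfl rfl]
      · change (if s'.1 = s.1 then _ else if s'.1 ⊆ s.1 then _ else _) = _
        rw [if_neg fun h => hs (Subtype.ext h), if_neg fun h => hs (Cell.eq_of_subset h)]
    rw [e']
    linarith

/-! ### The 0-form coefficients -/

omit hK in
-- Each small node in `t` other than its barycentre is joined to that barycentre by a small edge,
-- along which the derivative rule determines its value.
lemma isDual0_unique {R₁ : Cell K 1 → SmallCell K 1 → ℝ} {R R' : Cell K 2 → SmallCell K 0 → ℝ}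
    (hR : IsDual0 o R₁ R) (hR' : IsDual0 o R₁ R') : R = R' := by
  ext t w
  by_cases hwt : w.1 0 ⊆ t.1
  swap
  · rw [hR.support t w hwt, hR'.support t w hwt]
  by_cases he : w.1 0 = t.1
  · rw [hR.dual t w he, hR'.dual t w he]
  obtain ⟨p, hp⟩ := w.nonempty 0
  let z : SmallCell K 1 := smallEdge (Finset.ssubset_iff_subset_ne.mpr ⟨hwt, he⟩) ⟨w.2.2 0, t.2.1⟩
  have e := hR.deriv t z ⟨p, hp, hwt hp⟩
  rw [← hR'.deriv t z ⟨p, hp, hwt hp⟩] at e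
  change onCell (R t) t.1 - onCell (R t) (w.1 0) = onCell (R' t) t.1 - onCell (R' t) (w.1 0) at e
  rw [onCell_eq _ w rfl, onCell_eq _ w rfl, onCell_of_mem _ t.2.1,
    onCell_of_mem _ t.2.1, hR.dual t _ rfl, hR'.dual t _ rfl] at e
  linarith

/-- Closedness of `∑_s D¹_{st} μ¹_{⋆s}`: its derivative is `D⁰D¹` applied to the 2-forms. -/
lemma sum_D1_mul_closed {R₁ : Cell K 1 → SmallCell K 1 → ℝ} (hR₁ : IsDual1 o R₁) (t : Cell K 2)
    {a : Cell K 0} {s' : Cell K 1} {t' : Cell K 2} (h : a.1 ⊆ s'.1) (h' : s'.1 ⊆ t'.1) :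
    ∑ s, o.D1 s t * onPair (R₁ s) s'.1 t'.1 - ∑ s, o.D1 s t * onPair (R₁ s) a.1 t'.1 +
      ∑ s, o.D1 s t * onPair (R₁ s) a.1 s'.1 = 0 := by
  rw [← Finset.sum_sub_distrib, ← Finset.sum_add_distrib]
  calc _ = ∑ s, ∑ b, dual2 o b (smallTriangle h h') * (o.D0 b s * o.D1 s t) := by
        refine Finset.sum_congr rfl fun s _ => ?_
        have e := IsDual1.deriv_all hK o hR₁ s (smallTriangle h h')
        change onPair (R₁ s) s'.1 t'.1 - onPair (R₁ s) a.1 t'.1 + onPair (R₁ s) a.1 s'.1 = _ at e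
        rw [← mul_sub, ← mul_add, e, Finset.mul_sum]
        exact Finset.sum_congr rfl fun _ _ => by ring
    _ = 0 := by
        rw [Finset.sum_comm]
        simp_rw [← Finset.mul_sum, o.sum_D0_mul_D1]
        simp

omit hK in
lemma sum_D1_mul_edge {R₁ : Cell K 1 → SmallCell K 1 → ℝ} (hR₁ : IsDual1 o R₁) (t : Cell K 2)
    {s' : Cell K 1} {t' : Cell K 2} (h' : s'.1 ⊆ t'.1) :
    ∑ s, o.D1 s t * onPair (R₁ s) s'.1 t'.1 = -(o.D1 s' t * o.D1 s' t') / 2 := by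
  simp_rw [IsDual1.onPair_edge o hR₁ _ h']
  rw [Finset.sum_eq_single s']
  · rw [if_pos rfl]
    ring
  · intro b _ hb
    rw [if_neg hb.symm, mul_zero]
  · simp

lemma exists_isDual0 (ho : o.IsCoherent) {R₁ : Cell K 1 → SmallCell K 1 → ℝ}
    (hR₁ : IsDual1 o R₁) : ∃ R, IsDual0 o R₁ R := by
  -- Inside `t` these are the only possible values, read off from the small edges that end at the
  -- barycentre of `t`.
  let u : Cell K 2 → Finset E → ℝ := fun t σ =>
    if σ ⊆ t.1 then if σ = t.1 then 1 else 1 + ∑ s, o.D1 s t * onPair (R₁ s) σ t.1 else 0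
  have hus : ∀ (t : Cell K 2) (s : Cell K 1), u t s.1 = if s.1 ⊆ t.1 then 1 / 2 else 0 := by
    intro t s
    have hne : s.1 ≠ t.1 := fun h => by
      have := s.2.2
      rw [h, t.2.2] at this
      omega
    simp only [u]
    split_ifs with h
    · rw [sum_D1_mul_edge o hR₁ t h, o.D1_mul_self h]
      norm_num
    · rfl
  have hut : ∀ t t' : Cell K 2, u t t'.1 = if t' = t then 1 else 0 := by
    intro t t'
    simp only [u]
    split_ifs with h1 h2 h3 h3 h3
    · rfl
    · exact absurd (Subtype.ext h2) h3
    · exact absurd (congrArg _ h3) h2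
    · exact absurd (Cell.eq_of_subset h1) h3
    · exact absurd (h3 ▸ subset_rfl) h1
    · rfl
  have hust : ∀ (t : Cell K 2) (s' : Cell K 1) (t' : Cell K 2), s'.1 ⊆ t'.1 →
      u t t'.1 - u t s'.1 = -∑ s, o.D1 s t * onPair (R₁ s) s'.1 t'.1 := by
    intro t s' t' h
    rw [sum_D1_mul_edge o hR₁ t h, hus, hut]
    by_cases hs : s'.1 ⊆ t.1
    · rw [if_pos hs]
      split_ifs with ht
      · subst ht
        rw [o.D1_mul_self h]
        norm_num
      -- Across an edge of `t` the value drops from one half to zero; coherence supplies the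
      -- matching sign.
      · rw [ho s' t t' (Ne.symm ht) hs h]
        have := o.D1_mul_self h
        linarith
    · rw [if_neg hs, o.D1_eq_zero hs, if_neg]
      · simp
      · rintro rfl
        exact hs h
  have hstar : ∀ (t : Cell K 2) (a : Cell K 0), a.1 ⊆ t.1 →
      (∀ s' : Cell K 1, a.1 ⊆ s'.1 →
        u t s'.1 - u t a.1 = -∑ s, o.D1 s t * onPair (R₁ s) a.1 s'.1) ∧
      ∀ t' : Cell K 2, a.1 ⊆ t'.1 →
        u t t'.1 - u t a.1 = -∑ s, o.D1 s t * onPair (R₁ s) a.1 t'.1 := by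
    intro t a ha
    have hiff : ∀ (s' : Cell K 1) (t' : Cell K 2), a.1 ⊆ s'.1 → s'.1 ⊆ t'.1 →
        (u t s'.1 - u t a.1 = -∑ s, o.D1 s t * onPair (R₁ s) a.1 s'.1 ↔
          u t t'.1 - u t a.1 = -∑ s, o.D1 s t * onPair (R₁ s) a.1 t'.1) := by
      intro s' t' h h'
      have e1 := hust t s' t' h'
      have e2 := hK.sum_D1_mul_closed o hR₁ t h h'
      constructor <;> intro <;> linarith
    obtain ⟨s₀, _, _, hs₀⟩ := exists_two_edges ha
    obtain ⟨h1, h2⟩ := (hs₀ s₀).mpr (.inl rfl)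
    -- The induction is seeded at `t` itself, where the equation is the definition of `u`.
    refine hK.star_induction a hiff s₀ h1 ((hiff s₀ t h1 h2).mpr ?_)
    have hne : a.1 ≠ t.1 := fun h => by
      have := a.2.2
      rw [h, t.2.2] at this
      omega
    simp only [u]
    rw [if_pos subset_rfl, if_pos trivial, if_pos ha, if_neg hne]
    ring
  refine ⟨fun t w => u t (w.1 0), fun t w hw => if_neg hw, fun t w hw => ?_, fun t z hz => ?_⟩
  · simp only [u]
    rw [if_pos hw.subset, if_pos hw]
  · rw [onCell_of_mem _ (z.2.2 0), onCell_of_mem _ (z.2.2 1)]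
    simp_rw [← fun s => onPair_eq (R₁ s) z rfl rfl]
    change u t (z.1 1) - u t (z.1 0) = _
    have hsub : ∀ a : Cell K 0, z.1 0 = a.1 → a.1 ⊆ t.1 := by
      intro a ha
      obtain ⟨x, hx⟩ := Finset.card_eq_one.mp a.2.2
      rw [ha, hx] at hz
      simpa [hx] using hz
    rcases hK.mem_small_edge z with ⟨s', t', h, e0, e1⟩ | ⟨a, s', h, e0, e1⟩ | ⟨a, t', h, e0, e1⟩
    · rw [e0, e1]
      exact hust t s' t' h
    · rw [e0, e1]
      exact (hstar t a (hsub a e0)).1 s' h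
    · rw [e0, e1]
      exact (hstar t a (hsub a e0)).2 t' h

omit hK in
/-- `dμ⁰ = -D¹ μ¹` holds on the whole surface. -/
lemma IsDual0.deriv_all {R₁ : Cell K 1 → SmallCell K 1 → ℝ} {R : Cell K 2 → SmallCell K 0 → ℝ}
    (hR₁ : IsDual1 o R₁) (hR : IsDual0 o R₁ R) (t : Cell K 2) (z : SmallCell K 1) :
    onCell (R t) (z.1 1) - onCell (R t) (z.1 0) = -∑ s, o.D1 s t * R₁ s z := by
  by_cases hz : ∃ p ∈ z.1 0, p ∈ t.1
  · exact hR.deriv t z hz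
  · have h0 : ¬ z.1 0 ⊆ t.1 := fun h => by
      obtain ⟨p, hp⟩ := z.nonempty 0
      exact hz ⟨p, hp, h hp⟩
    have h1 : ¬ z.1 1 ⊆ t.1 := fun h => h0 ((z.zero_subset 1).trans h)
    rw [onCell_of_mem _ (z.2.2 0), onCell_of_mem _ (z.2.2 1),
      hR.support t (smallNode (z.2.2 0)) h0, hR.support t (smallNode (z.2.2 1)) h1, Finset.sum_eq_zero]
    · simp
    · intro s _
      by_cases hs : s.1 ⊆ t.1
      · rw [hR₁.support s z fun h => h0 (h.trans hs), mul_zero]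
      · rw [o.D1_eq_zero hs, zero_mul]

/-- The coefficients of the dual 0-forms at every small node sum to one. -/
lemma IsDual0.sum_eq_one (ho : o.IsCoherent) {R₁ : Cell K 1 → SmallCell K 1 → ℝ}
    {R : Cell K 2 → SmallCell K 0 → ℝ} (hR₁ : IsDual1 o R₁) (hR : IsDual0 o R₁ R)
    (w : SmallCell K 0) : ∑ t, R t w = 1 := by
  have hfacet : ∀ t' : Cell K 2, ∑ t, R t (smallNode t'.2.1) = 1 := by
    intro t'
    rw [Finset.sum_eq_single t']
    · exact hR.dual t' _ rfl
    · intro t _ ht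
      exact hR.support t _ fun h => ht (Cell.eq_of_subset h).symm
    · simp
  obtain ⟨t', ht'⟩ := hK.pure _ (w.2.2 0)
  by_cases he : w.1 0 = t'.1
  · rw [← hfacet t']
    exact Finset.sum_congr rfl fun t _ => congrArg _ (SmallCell.eq_of_zero he)
  let z : SmallCell K 1 := smallEdge (Finset.ssubset_iff_subset_ne.mpr ⟨ht', he⟩) ⟨w.2.2 0, t'.2.1⟩
  have e : ∑ t, (R t (smallNode t'.2.1) - R t w) = ∑ t, -∑ s, o.D1 s t * R₁ s z := by
    refine Finset.sum_congr rfl fun t _ => ?_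
    rw [← IsDual0.deriv_all o hR₁ hR t z]
    change _ = onCell (R t) t'.1 - onCell (R t) (w.1 0)
    rw [onCell_of_mem _ t'.2.1, onCell_eq _ w rfl]
  rw [Finset.sum_sub_distrib, hfacet, Finset.sum_neg_distrib, Finset.sum_comm] at e
  -- After exchanging the sums, each edge meets its two facets with opposite signs.
  simp_rw [← Finset.sum_mul, hK.sum_D1 o ho] at e
  simp only [zero_mul, Finset.sum_const_zero, neg_zero] at e
  linarith

end IsClosedSurface

/-! ### Barycentric coordinates in the refinement -/

/-- Sorting the barycentric coordinates of a point in a facet decreasingly selects a small triangle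
that contains it. -/
lemma exists_isRefinedCoords (x : interface K) : ∃ c, IsRefinedCoords (K := K) x.1 c := by
  obtain ⟨x, hx⟩ := x
  obtain ⟨t, ht⟩ := Set.mem_iUnion.mp hx
  rw [Finset.mem_convexHull'] at ht
  obtain ⟨y, hy0, hy1, hyx⟩ := ht
  obtain ⟨p, q, r, hpq, hpr, hqr, htt, h1, h2⟩ : ∃ p q r, p ≠ q ∧ p ≠ r ∧ q ≠ r ∧
      t.1 = {p, q, r} ∧ y q ≤ y p ∧ y r ≤ y q := by
    obtain ⟨p, hp, hmax⟩ := Finset.exists_max_image t.1 y (K.nonempty_of_mem_faces t.2.1)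
    obtain ⟨q, r, hqr, he, hle⟩ : ∃ q r, q ≠ r ∧ t.1.erase p = {q, r} ∧ y r ≤ y q := by
      obtain ⟨q, r, hqr, he⟩ := Finset.card_eq_two.mp
        (show (t.1.erase p).card = 2 by rw [Finset.card_erase_of_mem hp, t.2.2])
      rcases le_total (y r) (y q) with h | h
      · exact ⟨q, r, hqr, he, h⟩
      · exact ⟨r, q, hqr.symm, by rw [he, Finset.pair_comm], h⟩
    have hq : q ∈ t.1.erase p := by simp [he]
    have hr : r ∈ t.1.erase p := by simp [he]
    exact ⟨p, q, r, (Finset.ne_of_mem_erase hq).symm, (Finset.ne_of_mem_erase hr).symm, hqr,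
      by rw [← he, Finset.insert_erase hp], hmax q (Finset.mem_of_mem_erase hq), hle⟩
  have hfp : ({p} : Finset E) ∈ K.faces := K.down_closed t.2.1 (by simp [htt]) (by simp)
  have hfq : ({p, q} : Finset E) ∈ K.faces :=
    K.down_closed t.2.1 (by simp [htt, Finset.insert_subset_iff]) (by simp)
  have hr : 0 ≤ y r := hy0 r (by simp [htt])
  rw [htt] at hy1 hyx
  rw [Finset.sum_insert (by simp [hpq, hpr]), Finset.sum_pair hqr] at hy1 hyx
  let w : Fin 3 → SmallCell K 0 := ![smallNode hfp, smallNode hfq, smallNode t.2.1]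
  -- Abel summation of the sorted coordinates; the factors `2` and `3` undo the averaging in the
  -- barycentres.
  let b : Fin 3 → ℝ := ![y p - y q, 2 * (y q - y r), 3 * y r]
  have hw0 : (w 0).1 0 = {p} := rfl
  have hw1 : (w 1).1 0 = {p, q} := rfl
  have hw2 : (w 2).1 0 = {p, q, r} := htt
  have hmono : Monotone fun i => (w i).1 0 := by
    rw [Fin.monotone_iff_le_succ]
    intro i
    fin_cases i
    · change (w 0).1 0 ⊆ (w 1).1 0
      rw [hw0, hw1]
      simp
    · change (w 1).1 0 ⊆ (w 2).1 0
      rw [hw1, hw2]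
      grind
  refine ⟨fun v => ∑ i, if w i = v then b i else 0, fun v => ?_, fun v v' hv hv' => ?_, ?_, ?_⟩
  · refine Finset.sum_nonneg fun i _ => ?_
    split_ifs
    · fin_cases i <;> simp [b] <;> linarith
    · rfl
  · obtain ⟨i, -, hi⟩ := Finset.exists_ne_zero_of_sum_ne_zero hv
    obtain ⟨j, -, hj⟩ := Finset.exists_ne_zero_of_sum_ne_zero hv'
    obtain rfl : w i = v := by
      by_contra h
      exact hi (if_neg h)
    obtain rfl : w j = v' := by
      by_contra h
      exact hj (if_neg h)
    exact (le_total i j).imp (fun h => hmono h) (fun h => hmono h)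
  · rw [Finset.sum_comm]
    simp only [Finset.sum_ite_eq, Finset.mem_univ, if_true]
    rw [Fin.sum_univ_three]
    change y p - y q + 2 * (y q - y r) + 3 * y r = 1
    linarith
  · simp_rw [Finset.sum_smul, ite_smul, zero_smul]
    rw [Finset.sum_comm]
    simp only [Finset.sum_ite_eq, Finset.mem_univ, if_true]
    rw [Fin.sum_univ_three, hw0, hw1, hw2, ← hyx]
    change (y p - y q) • _ + (2 * (y q - y r)) • _ + (3 * y r) • _ = _
    simp only [barycentre]
    rw [Finset.sum_pair hpq, Finset.sum_insert (by simp [hpq, hpr]), Finset.sum_pair hqr,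
      Finset.card_pair hpq, Finset.card_eq_three.mpr ⟨p, q, r, hpq, hpr, hqr, rfl⟩]
    simp only [Finset.card_singleton, Finset.sum_singleton]
    module

/-- All hat functions at `x` use the same chosen coordinate system, so its existence is enough. -/
lemma sum_hat (x : interface K) : ∑ w, hat w x = 1 := by
  have h := exists_isRefinedCoords x
  simp only [hat, dif_pos h]
  exact h.choose_spec.2.2.1

lemma sum_zeroForm {R : Coefficients K} (hR : ∀ w, ∑ t, R.R0 t w = 1) (x : interface K) :
    ∑ t, R.zeroForm t x = 1 := by
  simp only [Coefficients.zeroForm]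
  rw [Finset.sum_comm, ← sum_hat x]
  refine Finset.sum_congr rfl fun w _ => ?_
  rw [← Finset.sum_mul, hR, one_mul]

end BuffaChristiansen

/-! ### Existence, uniqueness and partition of unity -/

theorem mainTheorem7 {E : Type*} [AddCommGroup E] [Module ℝ E]
    (K : Geometry.SimplicialComplex ℝ E) [Finite K.faces]
    (hK : BuffaChristiansen.IsClosedSurface K)
    (o : BuffaChristiansen.CellOrientation K) (ho : o.IsCoherent) :
    (∃! R : BuffaChristiansen.Coefficients K, BuffaChristiansen.IsBuffaChristiansen o R) ∧
      ∀ R : BuffaChristiansen.Coefficients K, BuffaChristiansen.IsBuffaChristiansen o R →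
        ∀ x : BuffaChristiansen.interface K,
          ∑ t : BuffaChristiansen.Cell K 2, R.zeroForm t x = 1 := by
  constructor
  · obtain ⟨R₁, h₁⟩ := hK.exists_isDual1 o ho
    obtain ⟨R₀, h₀⟩ := hK.exists_isDual0 o ho h₁
    refine ⟨⟨R₀, R₁, BuffaChristiansen.dual2 o⟩,
      (hK.isBuffaChristiansen_iff o _).mpr ⟨rfl, h₁, h₀⟩, fun R hR => ?_⟩
    obtain ⟨h2, h1, h0⟩ := (hK.isBuffaChristiansen_iff o R).mp hR
    have e1 := hK.isDual1_unique o h1 h₁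
    -- The rules for the 0-forms involve the 1-form coefficients, so these must be identified first.
    rw [e1] at h0
    exact BuffaChristiansen.Coefficients.ext
      (BuffaChristiansen.IsClosedSurface.isDual0_unique o h0 h₀) e1 h2
  · intro R hR x
    obtain ⟨-, h1, h0⟩ := (hK.isBuffaChristiansen_iff o R).mp hR
    exact BuffaChristiansen.sum_zeroForm
      (BuffaChristiansen.IsClosedSurface.IsDual0.sum_eq_one hK o ho h1 h0) x
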